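/- Let $X$ be a real or complex Banach space, and let $(x_i^0)_{i=1}^\infty$ and $(x_i^1)_{i=1}^\infty$ be two $C$-unconditional Schauder bases of $X$ with biorthogonal functionals $(x_i^{0*})_{i=1}^\infty$ and $(x_i^{1*})_{i=1}^\infty$, respectively. Here a Schauder basis $(x_i)$ with biorthogonal functionals $(x_i^*)$ is unconditional if, for every $x\in X$, the series $\sum_i x_i^*(x)x_i$ converges in every order, and it is $K$-unconditional if moreover $\|\sum_i \varepsilon_i x_i^*(x)x_i\|\le K\|x\|$ for all $x\in X$ and all $\varepsilon_i\in\{-1,1\}$. For $\Gamma\subseteq\mathbb{N}$ write $[x_i]_{i\in\Gamma}$ for the closed linear span of $\{x_i\}_{i\in\Gamma}$, and for closed subspaces $X_0,X_1$ of $X$ put $$d(X_0,X_1)=\inf\{\|x-y\| : x\in X_j,\ \|x\|=1,\ y\in X_{1-j},\ j\in\{0,1\}\}.$$ The following are equivalent: (i) For every $\sigma\in\{0,1\}^{\mathbb N}$, $(x_i^{\sigma(i)})_{i=1}^\infty$ is an unconditional basis of $X$. (ii) There is a $K>0$ such that for every $\sigma\in\{0,1\}^{\mathbb N}$, $(x_i^{\sigma(i)})_{i=1}^\infty$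 is a $K$-unconditional basis of $X$. (iii) For every $\sigma\in\{0,1\}^{\mathbb N}$, $(x_i^{\sigma(i)},x_i^{\sigma(i)*})_{i=1}^\infty$ is an unconditional approximate Schauder frame for $X$; that is, the operator $S(x)=\sum_{i=1}^\infty x_i^{\sigma(i)*}(x)\,x_i^{\sigma(i)}$ is well defined on $X$ and bounded with bounded inverse, and for every $x\in X$ the series converges to $S(x)$ in every order. (iv) For every $\sigma\in\{0,1\}^{\mathbb N}$, $(x_i^{\sigma(i)})_{i=1}^\infty$ is an unconditional basic sequence, that is, an unconditional basis of its closed linear span. (v) There is a $D>0$ such that for every $\sigma\in\{0,1\}^{\mathbb N}$, $$d\big([x_i^0]_{i\in\sigma^{-1}(0)},[x_i^1]_{i\in\sigma^{-1}(1)}\big)\ge D^{-1}.$$ (vi) There is an $E>0$ such that for every $\sigma\in\{0,1\}^{\mathbb N}$, if $P$ is the basis projection $P(x)=\sum_{i\in\sigma^{-1}(0)}x_i^{0*}(x)x_i^0$ onto $[x_i^0]_{i\in\sigma^{-1}(0)}$ and $Q$ is the basis projection $Q(x)=\sum_{i\in\sigma^{-1}(0)}x_i^{1*}(x)x_i^1$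 onto $[x_i^1]_{i\in\sigma^{-1}(0)}$, then the restrictions $$P|:[x_i^1]_{i\in\sigma^{-1}(0)}\to[x_i^0]_{i\in\sigma^{-1}(0)}\quad\text{and}\quad Q|:[x_i^0]_{i\in\sigma^{-1}(0)}\to[x_i^1]_{i\in\sigma^{-1}(0)}$$ are invertible, with inverses of norm at most $E$. -/

import Mathlib

open Set

noncomputable section

section WovenBases

variable {𝕜 : Type*} [RCLike 𝕜] {X : Type*} [NormedAddCommGroup X] [NormedSpace 𝕜 X]

/-- The series `∑ u i` converges to `s` in the given order, i.e. its sequence of partial sums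
tends to `s`. -/
def SeriesTo (u : ℕ → X) (s : X) : Prop :=
  HasSum u s (SummationFilter.conditional ℕ)

/-- The partial-sum form of convergence. -/
theorem seriesTo_iff (u : ℕ → X) (s : X) :
    SeriesTo u s ↔
      Filter.Tendsto (fun n => ∑ i ∈ Finset.range n, u i) Filter.atTop (nhds s) := by
  simp only [SeriesTo, HasSum, SummationFilter.conditional_filter_eq_map_range,
    Filter.tendsto_map'_iff, Function.comp_def]

/-- A Schauder basis is unconditional if the expansion of every vector converges in every
order. -/
def IsUnconditional (b : SchauderBasis 𝕜 X) : Prop :=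
  ∀ (y : X) (π : Equiv.Perm ℕ), SeriesTo (fun i => b.coord (π i) y • b (π i)) y

/-- A `K`-unconditional Schauder basis: it is unconditional, and
`‖∑ ε i • (x i)* y • x i‖ ≤ K ‖y‖` for every vector `y` and all signs `ε i`. -/
def IsKUnconditional (K : ℝ) (b : SchauderBasis 𝕜 X) : Prop :=
  IsUnconditional b ∧
    ∀ (y : X) (ε : ℕ → 𝕜), (∀ i, ε i = 1 ∨ ε i = -1) →
      ∃ z : X, SeriesTo (fun i => ε i • b.coord i y • b i) z ∧ ‖z‖ ≤ K * ‖y‖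

variable (𝕜)

/-- The sequence `x` is an unconditional Schauder basis of `X`. -/
def IsUnconditionalBasis (x : ℕ → X) : Prop :=
  ∃ b : SchauderBasis 𝕜 X, (∀ i, b i = x i) ∧ IsUnconditional b

/-- The sequence `x` is a `K`-unconditional Schauder basis of `X`. -/
def IsKUnconditionalBasis (K : ℝ) (x : ℕ → X) : Prop :=
  ∃ b : SchauderBasis 𝕜 X, (∀ i, b i = x i) ∧ IsKUnconditional K b

/-- The closed linear span of the vectors `x i`, `i ∈ Γ`. -/
def closedSpan (x : ℕ → X) (Γ : Set ℕ) : Submodule 𝕜 X :=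
  (Submodule.span 𝕜 (x '' Γ)).topologicalClosure

theorem mem_closedSpan (x : ℕ → X) {Γ : Set ℕ} {i : ℕ} (hi : i ∈ Γ) :
    x i ∈ closedSpan 𝕜 x Γ :=
  Submodule.le_topologicalClosure _ (Submodule.subset_span (mem_image_of_mem x hi))

/-- The sequence `x` is an unconditional basic sequence: it is an unconditional Schauder basis
of its closed linear span. -/
def IsUnconditionalBasicSequence (x : ℕ → X) : Prop :=
  IsUnconditionalBasis 𝕜
    (fun i => (⟨x i, mem_closedSpan 𝕜 x (mem_univ i)⟩ : closedSpan 𝕜 x univ))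

variable {𝕜}

/-- `(x i, f i)` is an unconditional approximate Schauder frame: the frame operator
`S y = ∑ f i y • x i` is a well defined bounded operator with bounded inverse, and the series
converges to `S y` in every order. -/
def IsUnconditionalApproxSchauderFrame (x : ℕ → X) (f : ℕ → StrongDual 𝕜 X) : Prop :=
  ∃ S : X ≃L[𝕜] X,
    (∀ y, SeriesTo (fun i => f i y • x i) (S y)) ∧
    ∀ (y : X) (π : Equiv.Perm ℕ), SeriesTo (fun i => f (π i) y • x (π i)) (S y)

/-- The distance between two subspaces: how close a unit vector of one of them can be to a
vector of the other. -/
def subspaceDist (Y Z : Submodule 𝕜 X) : ℝ :=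
  sInf {r : ℝ | ∃ u v : X, ((u ∈ Y ∧ v ∈ Z) ∨ (u ∈ Z ∧ v ∈ Y)) ∧ ‖u‖ = 1 ∧ r = ‖u - v‖}

/-- `P` is the basis projection of `b` onto the closed span of the `b i`, `i ∈ Γ`, that is,
`P y = ∑ i ∈ Γ, (b i)* y • b i`. -/
def IsBasisProjection (b : SchauderBasis 𝕜 X) (Γ : Set ℕ) (P : X →L[𝕜] X) : Prop :=
  ∀ y, SeriesTo (Γ.indicator fun i => b.coord i y • b i) (P y)

/-- The restriction of `P` to `Y` is an invertible operator from `Y` onto `Z` whose inverse has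
norm at most `E`. -/
def RestrictsToInvertible (P : X →L[𝕜] X) (Y Z : Submodule 𝕜 X) (E : ℝ) : Prop :=
  ∃ T : Y ≃L[𝕜] Z, (∀ y : Y, (T y : X) = P y) ∧ ‖(T.symm : Z →L[𝕜] Y)‖ ≤ E

end WovenBases

end

/-! Unconditionality is used in a finite form: deleting terms from a finite linear combination
multiplies its norm by at most a constant (`IsSuppressionUnconditional`). For nonzero vectors this
characterises unconditional basic sequences, and with dense span it gives an unconditional basis.
For a weaving of two unconditional bases it follows from separation of the two parts: a finite sum
splits into one piece per basis, and separation bounds each piece by the whole.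

The hard point is that basic sequences, with constants depending on the weaving, force uniform
separation (`exists_norm_weavingPart_le`). Otherwise there are finite sums, in varying weavings,
that tend to zero while their parts from the first basis have norm one. By compactness the weavings
and coefficients converge pointwise along a subsequence. The limit coefficients vanish, so the mass
escapes to infinity, and a gliding hump glues the tails into one weaving whose suppression constant
is violated.

That the limit coefficients vanish comes from `exists_bounded_sum_deviation`. The glued tails are,
up to summable errors, the deviations of the limit vector from partial sums of the limit weaving.
Alternating sums of these deviations telescope to bounded block sums of the limit; unconditionality
of the glued weaving removes the signs, so the plain sums are bounded too. A fixed nonzero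
contribution repeated in every deviation would make them grow linearly.

The same bound yields completeness of every weaving from separation (`dense_span_weaving`).
Exchanging one vector at a time preserves density; an arbitrary weaving is a limit of finite
exchanges, and a functional annihilating it takes the same value on all deviations of a given
vector, hence kills that vector. The frame and projection conditions are then algebra with basis
projections. -/

/-! ### Convergence in every order implies summability. -/

section Rearrangements

/-- The index of the block `[m k, m (k+1))` containing a given number. -/
theorem exists_blockIndex {m : ℕ → ℕ} (hm : StrictMono m) (h0 : m 0 = 0) :
    ∃ B : ℕ → ℕ, ∀ i k, B i = k ↔ m k ≤ i ∧ i < m (k + 1) := by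
  have hex : ∀ i, ∃ k, m k ≤ i ∧ i < m (k + 1) := by
    intro i
    refine ⟨Nat.findGreatest (fun k => m k ≤ i) i, ?_, ?_⟩
    · exact Nat.findGreatest_spec (P := fun k => m k ≤ i) (Nat.zero_le i) (by simp [h0])
    · by_contra! h
      have h1 := hm.le_apply (x := Nat.findGreatest (fun k => m k ≤ i) i + 1)
      have h2 := Nat.le_findGreatest (P := fun k => m k ≤ i) (h1.trans h) h
      omega
  choose B hB using hex
  refine ⟨B, fun i k => ⟨fun h => h ▸ hB i, fun h => ?_⟩⟩
  have h1 := hm.lt_iff_lt.1 ((hB i).1.trans_lt h.2)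
  have h2 := hm.lt_iff_lt.1 (h.1.trans_lt (hB i).2)
  omega

/-- A permutation of `ℕ` that preserves `[a, c)` and maps an initial segment of it onto a given
subset. -/
theorem exists_perm_initial_segment {a c : ℕ} (hac : a ≤ c) (t : Finset ℕ)
    (ht : t ⊆ Finset.Ico a c) :
    ∃ e : Equiv.Perm ℕ, (∀ i, (a ≤ e i ∧ e i < c) ↔ (a ≤ i ∧ i < c)) ∧
      (Finset.Ico a (a + t.card)).image e = t ∧ a + t.card ≤ c := by
  have hcard : t.card ≤ c - a := by simpa using Finset.card_le_card ht
  have hac' : a + t.card ≤ c := by omega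
  have hS : Finset.Ico a (a + t.card) ⊆ Finset.Ico a c := Finset.Ico_subset_Ico_right hac'
  let e0 : Finset.Ico a (a + t.card) ≃ t := Finset.equivOfCardEq (by simp)
  let f : Finset.Ico a (a + t.card) → {i // a ≤ i ∧ i < c} :=
    fun i => ⟨i, by simpa using hS i.2⟩
  let g : Finset.Ico a (a + t.card) → {i // a ≤ i ∧ i < c} :=
    fun i => ⟨e0 i, by simpa using ht (e0 i).2⟩
  have hf : Function.Injective f := fun i j h => Subtype.ext (by simpa [f] using h)
  have hg : Function.Injective g := fun i j h =>
    e0.injective (Subtype.ext (by simpa [g] using h))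
  obtain ⟨σ, hσ⟩ := Equiv.Perm.exists_extending_pair f g hf hg
  have hval : ∀ i (hi : i ∈ Finset.Ico a (a + t.card)),
      Equiv.Perm.ofSubtype σ i = (e0 ⟨i, hi⟩ : ℕ) := by
    intro i hi
    have hi' : a ≤ i ∧ i < c := by simpa using hS hi
    rw [Equiv.Perm.ofSubtype_apply_of_mem σ hi']
    exact congrArg Subtype.val (hσ ⟨i, hi⟩)
  refine ⟨Equiv.Perm.ofSubtype σ, fun i => ?_, ?_, hac'⟩
  · by_cases hi : a ≤ i ∧ i < c
    · rw [Equiv.Perm.ofSubtype_apply_of_mem σ hi]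
      exact iff_of_true (σ ⟨i, hi⟩).2 hi
    · rw [Equiv.Perm.ofSubtype_apply_of_not_mem σ hi]
  · apply Finset.eq_of_subset_of_card_le
    · intro j hj
      obtain ⟨i, hi, rfl⟩ := Finset.mem_image.1 hj
      rw [hval i hi]
      exact (e0 ⟨i, hi⟩).2
    · rw [Finset.card_image_of_injective _ (Equiv.injective _)]
      simp

/-- A permutation of `ℕ` glued from permutations of the blocks of a partition. -/
theorem exists_perm_glue (B : ℕ → ℕ) (e : ℕ → Equiv.Perm ℕ)
    (he : ∀ k i, B (e k i) = k ↔ B i = k) :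
    ∃ π : Equiv.Perm ℕ, ∀ i, π i = e (B i) i := by
  refine ⟨⟨fun i => e (B i) i, fun i => (e (B i)).symm i, fun i => ?_, fun i => ?_⟩, fun i => rfl⟩
  · have : B (e (B i) i) = B i := (he _ _).2 rfl
    simp [this]
  · have : B ((e (B i)).symm i) = B i := (he _ _).1 (by simp)
    simp [this]

/-- A series in a Banach space that converges in every order is summable. -/
theorem hasSum_of_forall_perm {X : Type*} [NormedAddCommGroup X] [CompleteSpace X] {u : ℕ → X}
    {s : X} (h : ∀ π : Equiv.Perm ℕ, SeriesTo (fun i => u (π i)) s) : HasSum u s := by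
  suffices hu : Summable u by
    have h1 := (seriesTo_iff _ _).1 (h 1)
    have h2 := hu.hasSum.tendsto_sum_nat
    rw [← tendsto_nhds_unique h2 h1]
    exact hu.hasSum
  by_contra hu
  rw [summable_iff_vanishing_norm] at hu
  push Not at hu
  obtain ⟨ε, hε, hu⟩ := hu
  -- Failure of the Cauchy criterion gives sums of norm at least `ε` beyond every index; iterating
  -- `next` arranges them in consecutive blocks.
  have hstep : ∀ m : ℕ, ∃ t : Finset ℕ, ∃ m', m < m' ∧ t ⊆ Finset.Ico m m' ∧
      ε ≤ ‖∑ i ∈ t, u i‖ := by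
    intro m
    obtain ⟨t, ht, hεt⟩ := hu (Finset.range m)
    refine ⟨t, max (m + 1) (t.sup id + 1), by omega, fun i hi => ?_, hεt⟩
    have h1 : i ∉ Finset.range m := Finset.disjoint_left.1 ht hi
    have h2 : i ≤ t.sup id := Finset.le_sup (f := id) hi
    simp only [Finset.mem_range, Finset.mem_Ico] at h1 ⊢
    omega
  choose t next hlt hsub ht using hstep
  let m : ℕ → ℕ := fun k => next^[k] 0
  have hsucc : ∀ k, m (k + 1) = next (m k) := fun k => Function.iterate_succ_apply' _ _ _
  have hm : StrictMono m := strictMono_nat_of_lt_succ fun k => by rw [hsucc]; exact hlt _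
  obtain ⟨B, hB⟩ := exists_blockIndex hm rfl
  -- Within each block the large set is listed first, so the rearranged series has contiguous
  -- segments of norm at least `ε` arbitrarily far out.
  have hperm : ∀ k, ∃ e : Equiv.Perm ℕ, (∀ i, B (e i) = k ↔ B i = k) ∧
      (Finset.Ico (m k) (m k + (t (m k)).card)).image e = t (m k) ∧
      m k + (t (m k)).card ≤ m (k + 1) := by
    intro k
    obtain ⟨e, he, hi, hc⟩ := exists_perm_initial_segment (hlt (m k)).le (t (m k)) (hsub (m k))
    refine ⟨e, fun i => ?_, hi, by rw [hsucc]; exact hc⟩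
    rw [hB, hB, hsucc]
    exact he i
  choose e he hi hc using hperm
  obtain ⟨π, hπ⟩ := exists_perm_glue B e he
  have hcau := ((seriesTo_iff _ _).1 (h π)).cauchySeq
  obtain ⟨N, hN⟩ := Metric.cauchySeq_iff.1 hcau ε hε
  have hk := hN (m N + (t (m N)).card) ((hm.le_apply).trans (Nat.le_add_right _ _)) (m N)
    hm.le_apply
  rw [dist_eq_norm, ← Finset.sum_Ico_eq_sub _ (Nat.le_add_right _ _)] at hk
  have heq : ∑ i ∈ Finset.Ico (m N) (m N + (t (m N)).card), u (π i) = ∑ i ∈ t (m N), u i := by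
    rw [← hi N, Finset.sum_image fun a _ b _ hab => (e N).injective hab, hi N]
    refine Finset.sum_congr rfl fun i hiN => ?_
    rw [Finset.mem_Ico] at hiN
    rw [hπ, (hB i N).2 ⟨hiN.1, hiN.2.trans_le (hc N)⟩]
  rw [heq] at hk
  exact (ht (m N)).not_gt hk

end Rearrangements

/-! ### Unconditional bases and the suppression inequality. -/

section Unconditional

variable {𝕜 : Type*} [RCLike 𝕜] {X : Type*} [NormedAddCommGroup X] [NormedSpace 𝕜 X]

variable (𝕜) in
/-- The sequence `z` satisfies the suppression form of unconditionality with constant `L`: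
omitting terms from a finite linear combination increases its norm at most by the factor `L`. -/
def IsSuppressionUnconditional (L : ℝ) (z : ℕ → X) : Prop :=
  ∀ (a : ℕ → 𝕜) (s t : Finset ℕ), s ⊆ t → ‖∑ i ∈ s, a i • z i‖ ≤ L * ‖∑ i ∈ t, a i • z i‖

theorem isSuppressionUnconditional_coe {L : ℝ} {S : Submodule 𝕜 X} {z : ℕ → S} :
    IsSuppressionUnconditional 𝕜 L (fun i => (z i : X)) ↔ IsSuppressionUnconditional 𝕜 L z := by
  have h : ∀ (a : ℕ → 𝕜) (s : Finset ℕ), ‖∑ i ∈ s, a i • (z i : X)‖ = ‖∑ i ∈ s, a i • z i‖ := by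
    intro a s
    rw [← Submodule.norm_coe, Submodule.coe_sum]
    simp only [Submodule.coe_smul]
  simp only [IsSuppressionUnconditional, h]

theorem HasSum.seriesTo {u : ℕ → X} {s : X} (h : HasSum u s) : SeriesTo u s :=
  (seriesTo_iff _ _).2 h.tendsto_sum_nat

theorem HasSum.seriesTo_perm {u : ℕ → X} {s : X} (h : HasSum u s) (π : Equiv.Perm ℕ) :
    SeriesTo (fun i => u (π i)) s :=
  HasSum.seriesTo (π.hasSum_iff.2 h)

theorem SeriesTo.congr {u v : ℕ → X} {s : X} (h : SeriesTo u s) (huv : ∀ i, u i = v i) :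
    SeriesTo v s :=
  funext huv ▸ h

theorem SeriesTo.unique {u : ℕ → X} {s t : X} (hs : SeriesTo u s) (ht : SeriesTo u t) : s = t :=
  HasSum.unique hs ht

theorem IsUnconditional.hasSum [CompleteSpace X] {b : SchauderBasis 𝕜 X} (hb : IsUnconditional b)
    (y : X) : HasSum (fun i => b.coord i y • b i) y :=
  hasSum_of_forall_perm (u := fun i => b.coord i y • b i) (hb y)

/-- The finite coordinate projections are uniformly bounded, and suppressing terms means applying
one of them. -/
theorem IsUnconditional.exists_isSuppressionUnconditional [CompleteSpace X]
    {b : SchauderBasis 𝕜 X} (hb : IsUnconditional b) :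
    ∃ L, 0 ≤ L ∧ IsSuppressionUnconditional 𝕜 L b := by
  let b' : UnconditionalSchauderBasis ℕ 𝕜 X := ⟨b.basis, b.coord, b.ortho, hb.hasSum⟩
  obtain ⟨L, hL⟩ := b'.exists_norm_proj_le
  refine ⟨L, (norm_nonneg _).trans (hL ∅), fun a s t hst => ?_⟩
  have : ∑ i ∈ s, a i • b i = b'.proj s (∑ i ∈ t, a i • b i) := by
    classical
    rw [map_sum]
    have : ∀ i, b'.proj s (a i • b i) = if i ∈ s then a i • b i else 0 := fun i => by
      rw [map_smul, b'.proj_apply_basis_mem]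
      split_ifs
      · rfl
      · rw [smul_zero]
    simp_rw [this]
    rw [Finset.sum_ite_mem, Finset.inter_eq_right.2 hst]
  rw [this]
  exact (b'.proj s).le_of_opNorm_le (hL s) _

theorem IsUnconditionalBasis.exists_isSuppressionUnconditional [CompleteSpace X] {x : ℕ → X}
    (hx : IsUnconditionalBasis 𝕜 x) : ∃ L, 0 ≤ L ∧ IsSuppressionUnconditional 𝕜 L x := by
  obtain ⟨b, hbx, hb⟩ := hx
  rw [← funext hbx]
  exact hb.exists_isSuppressionUnconditional

theorem IsUnconditionalBasicSequence.exists_isSuppressionUnconditional [CompleteSpace X]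
    {x : ℕ → X} (hx : IsUnconditionalBasicSequence 𝕜 x) :
    ∃ L, 0 ≤ L ∧ IsSuppressionUnconditional 𝕜 L x := by
  have : CompleteSpace (closedSpan 𝕜 x univ) :=
    (Submodule.isClosed_topologicalClosure _).completeSpace_coe
  obtain ⟨L, hL0, hL⟩ := IsUnconditionalBasis.exists_isSuppressionUnconditional hx
  exact ⟨L, hL0, isSuppressionUnconditional_coe.2 hL⟩

/-- The coordinate functional of a suppression unconditional sequence, extended to the space. -/
theorem IsSuppressionUnconditional.exists_coord {L : ℝ} {z : ℕ → X}
    (hz : IsSuppressionUnconditional 𝕜 L z) (hz0 : ∀ i, z i ≠ 0) (j : ℕ) :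
    ∃ f : StrongDual 𝕜 X, ∀ i, f (z i) = if i = j then 1 else 0 := by
  have hcoef : ∀ (l : ℕ →₀ 𝕜) (i : ℕ),
      ‖l i‖ * ‖z i‖ ≤ L * ‖Finsupp.linearCombination 𝕜 z l‖ := by
    intro l i
    -- Suppressing all terms but one bounds a single coefficient; adding `i` to the support covers
    -- the case `l i = 0`.
    have := hz l {i} (insert i l.support) (by simp)
    rw [Finset.sum_singleton, norm_smul] at this
    rw [Finsupp.linearCombination_apply,
      Finsupp.sum_of_support_subset l (Finset.subset_insert i _) _ (by simp)]
    exact this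
  have hli : LinearIndependent 𝕜 z := by
    refine linearIndependent_iff.2 fun l hl => Finsupp.ext fun i => ?_
    have := hcoef l i
    rw [hl, norm_zero, mul_zero] at this
    have h2 : ‖l i‖ = 0 := by
      have := norm_pos_iff.2 (hz0 i)
      nlinarith [norm_nonneg (l i)]
    simpa using h2
  let f0 : Submodule.span 𝕜 (range z) →ₗ[𝕜] 𝕜 := (Finsupp.lapply j).comp hli.repr
  have hf0 : ∀ v, ‖f0 v‖ ≤ L / ‖z j‖ * ‖v‖ := by
    intro v
    have := hcoef (hli.repr v) j
    rw [hli.linearCombination_repr] at this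
    rw [div_mul_eq_mul_div, le_div_iff₀ (norm_pos_iff.2 (hz0 j))]
    exact this
  -- Hahn–Banach extends the bounded coefficient functional from the span.
  obtain ⟨f, hf, -⟩ := exists_extension_norm_eq (𝕜 := 𝕜) _ (f0.mkContinuous _ hf0)
  refine ⟨f, fun i => ?_⟩
  have hzi : z i ∈ Submodule.span 𝕜 (range z) := Submodule.subset_span (mem_range_self i)
  have h1 := hf ⟨z i, hzi⟩
  rw [h1]
  have : hli.repr ⟨z i, hzi⟩ = Finsupp.single i 1 := hli.repr_eq_single i _ rfl
  simp [f0, this, Finsupp.single_apply]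

theorem norm_hasSum_le {u : ℕ → X} {s : X} {R : ℝ} (h : HasSum u s)
    (hR : ∀ t : Finset ℕ, ‖∑ i ∈ t, u i‖ ≤ R) : ‖s‖ ≤ R :=
  le_of_tendsto (Filter.Tendsto.norm h) (Filter.Eventually.of_forall hR)

/-- A suppression unconditional sequence of nonzero vectors with dense span is an unconditional
Schauder basis. -/
theorem IsSuppressionUnconditional.exists_basis [CompleteSpace X] {L : ℝ} {z : ℕ → X}
    (hz : IsSuppressionUnconditional 𝕜 L z) (hz0 : ∀ i, z i ≠ 0)
    (hd : Dense (Submodule.span 𝕜 (range z) : Set X)) :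
    ∃ b : SchauderBasis 𝕜 X, (∀ i, b i = z i) ∧ IsKUnconditional (2 * L + 1) b := by
  classical
  choose f hf using hz.exists_coord hz0
  let P : Finset ℕ → X →L[𝕜] X := fun s => ∑ i ∈ s, (f i).smulRight (z i)
  have hP : ∀ s y, P s y = ∑ i ∈ s, f i y • z i := fun s y => by
    simp [P]
  have hPz : ∀ s i, P s (z i) = if i ∈ s then z i else 0 := fun s i => by
    simp [hP, hf]
  have hspan : ∀ y ∈ Submodule.span 𝕜 (range z), ∃ (a : ℕ → 𝕜) (t : Finset ℕ),
      y = ∑ i ∈ t, a i • z i := by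
    intro y hy
    obtain ⟨l, rfl⟩ := (Finsupp.mem_span_range_iff_exists_finsupp).1 hy
    exact ⟨l, l.support, rfl⟩
  have hPsum : ∀ s (a : ℕ → 𝕜) (t : Finset ℕ),
      P s (∑ i ∈ t, a i • z i) = ∑ i ∈ t ∩ s, a i • z i := by
    intro s a t
    simp [hPz, ← Finset.sum_ite_mem]
  have hbound : ∀ s y, ‖P s y‖ ≤ L * ‖y‖ := by
    intro s y
    refine hd.induction (P := fun y => ‖P s y‖ ≤ L * ‖y‖) ?_ ?_ y
    · intro y hy
      obtain ⟨a, t, rfl⟩ := hspan y hy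
      rw [hPsum]
      exact hz a _ _ Finset.inter_subset_left
    · exact isClosed_le (by fun_prop) (by fun_prop)
  have hL : 0 ≤ L := by
    have := hbound {0} (z 0)
    have h2 := norm_pos_iff.2 (hz0 0)
    nlinarith [norm_nonneg (P {0} (z 0))]
  have hsum : ∀ y, HasSum (fun i => f i y • z i) y := by
    intro y
    rw [HasSum, Metric.tendsto_nhds]
    intro ε hε
    obtain ⟨v, hv, hyv⟩ := Metric.mem_closure_iff.1 (hd y) (ε / (L + 1 + 1)) (by positivity)
    obtain ⟨a, t, rfl⟩ := hspan v hv
    refine (Filter.eventually_ge_atTop t).mono fun s hs => ?_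
    have h1 : P s (∑ i ∈ t, a i • z i) = ∑ i ∈ t, a i • z i := by
      rw [hPsum, Finset.inter_eq_left.2 hs]
    have h2 := hbound s (y - ∑ i ∈ t, a i • z i)
    rw [dist_eq_norm, lt_div_iff₀ (by positivity)] at hyv
    rw [← hP, dist_eq_norm]
    calc ‖P s y - y‖ = ‖P s (y - ∑ i ∈ t, a i • z i) - (y - ∑ i ∈ t, a i • z i)‖ := by
          rw [map_sub, h1]; congr 1; abel
      _ ≤ L * ‖y - ∑ i ∈ t, a i • z i‖ + ‖y - ∑ i ∈ t, a i • z i‖ :=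
          (norm_sub_le _ _).trans (by gcongr)
      _ < ε := by nlinarith [norm_nonneg (y - ∑ i ∈ t, a i • z i)]
  let b : SchauderBasis 𝕜 X :=
    ⟨z, f, fun i j => by simp [hf, Pi.single_apply, eq_comm], fun y => (hsum y).seriesTo⟩
  refine ⟨b, fun i => rfl, fun y π => (hsum y).seriesTo_perm π, fun y ε hε => ?_⟩
  -- The signed series is twice the subseries with sign `1` minus the full series, whence the
  -- constant `2 * L + 1`.
  obtain ⟨p, hp⟩ := (hsum y).summable.indicator {i | ε i = 1}
  have hpn : ‖p‖ ≤ L * ‖y‖ := norm_hasSum_le hp fun t => by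
    rw [Finset.sum_indicator_eq_sum_filter, ← hP]
    exact hbound _ y
  refine ⟨(2 : 𝕜) • p - y, ?_, ?_⟩
  · have h := (hp.const_smul (2 : 𝕜)).sub (hsum y)
    refine h.seriesTo.congr fun i => ?_
    by_cases hi : ε i = 1
    · simp [hi, two_smul]
      rfl
    · simp [(hε i).resolve_left hi, indicator_of_notMem (s := {i | ε i = 1}) (a := i) hi]
      rfl
  · calc ‖(2 : 𝕜) • p - y‖ ≤ 2 * ‖p‖ + ‖y‖ := by
          refine (norm_sub_le _ _).trans ?_
          rw [norm_smul]; simp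
      _ ≤ (2 * L + 1) * ‖y‖ := by nlinarith

theorem IsSuppressionUnconditional.isUnconditionalBasicSequence [CompleteSpace X] {L : ℝ}
    {z : ℕ → X} (hz : IsSuppressionUnconditional 𝕜 L z) (hz0 : ∀ i, z i ≠ 0) :
    IsUnconditionalBasicSequence 𝕜 z := by
  have : CompleteSpace (closedSpan 𝕜 z univ) :=
    (Submodule.isClosed_topologicalClosure _).completeSpace_coe
  obtain ⟨b, hbz, hb⟩ := IsSuppressionUnconditional.exists_basis (𝕜 := 𝕜) (L := L)
    (z := fun i => (⟨z i, mem_closedSpan 𝕜 z (mem_univ i)⟩ : closedSpan 𝕜 z univ))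
    (isSuppressionUnconditional_coe.1 hz)
    (fun i h => hz0 i (congrArg Subtype.val h)) (by
      intro y
      rw [closure_subtype]
      have hy : (y : X) ∈ closure (Submodule.span 𝕜 (z '' univ) : Set X) := y.2
      refine closure_mono (fun v hv => ?_) hy
      have hle : Submodule.span 𝕜 (z '' univ) ≤ (Submodule.span 𝕜 (range fun i =>
          (⟨z i, mem_closedSpan 𝕜 z (mem_univ i)⟩ : closedSpan 𝕜 z univ))).map
            (closedSpan 𝕜 z univ).subtype := by
        rw [Submodule.map_span, ← range_comp, image_univ]
        exact le_rfl
      exact hle hv)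
  exact ⟨b, hbz, hb.1⟩

/-- An unconditional basis with a sign constant has basis projections onto all the closed spans of
its subsequences. -/
theorem IsKUnconditional.exists_isBasisProjection {K : ℝ} {b : SchauderBasis 𝕜 X}
    (hb : IsKUnconditional K b) (Γ : Set ℕ) :
    ∃ P : X →L[𝕜] X, IsBasisProjection b Γ P ∧ ∀ y, ‖P y‖ ≤ (1 + K) / 2 * ‖y‖ := by
  classical
  let ε : ℕ → 𝕜 := fun i => if i ∈ Γ then 1 else -1
  have hε : ∀ i, ε i = 1 ∨ ε i = -1 := fun i => by
    by_cases h : i ∈ Γ <;> simp [ε, h]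
  have hex : ∀ y, ∃ p, SeriesTo (Γ.indicator fun i => b.coord i y • b i) p ∧
      ‖p‖ ≤ (1 + K) / 2 * ‖y‖ := by
    intro y
    obtain ⟨z, hz, hzn⟩ := hb.2 y ε hε
    -- The projection is the mean of the identity and the sign change that is `1` on `Γ` and `-1`
    -- off it.
    refine ⟨(2⁻¹ : 𝕜) • (y + z), ?_, ?_⟩
    · have h := ((b.expansion y).add hz).const_smul (2⁻¹ : 𝕜)
      refine SeriesTo.congr h fun i => ?_
      by_cases hi : i ∈ Γ
      · simp [hi, ε, ← two_smul 𝕜]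
      · simp [hi, ε]
    · have := norm_add_le y z
      rw [norm_smul, norm_inv, RCLike.norm_ofNat]
      linarith
  choose p hp hpn using hex
  let P : X →ₗ[𝕜] X :=
    { toFun := p
      map_add' := fun y y' => (hp (y + y')).unique <| by
        refine SeriesTo.congr (HasSum.add (hp y) (hp y')) fun i => ?_
        by_cases hi : i ∈ Γ <;> simp [hi, add_smul]
      map_smul' := fun c y => (hp (c • y)).unique <| by
        refine SeriesTo.congr (HasSum.const_smul c (hp y)) fun i => ?_
        by_cases hi : i ∈ Γ <;> simp [hi, mul_smul] }
  exact ⟨P.mkContinuous _ hpn, hp, hpn⟩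

end Unconditional

/-! ### Finite sums over consecutive blocks and over the even blocks. -/

section BlockSums

theorem sum_range_blocks {X : Type*} [AddCommMonoid X] {M : ℕ → ℕ} (hM : Monotone M)
    (h0 : M 0 = 0) (f : ℕ → X) (K : ℕ) :
    ∑ i ∈ Finset.range (M K), f i =
      ∑ k ∈ Finset.range K, ∑ i ∈ Finset.Ico (M k) (M (k + 1)), f i := by
  induction K with
  | zero => simp [h0]
  | succ K ih =>
    rw [Finset.sum_range_succ, ← ih, Finset.sum_range_add_sum_Ico _ (hM K.le_succ)]

theorem sum_range_two_mul_eq_add {X : Type*} [AddCommMonoid X] (f : ℕ → X) (K : ℕ) :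
    ∑ k ∈ Finset.range (2 * K), f k =
      ∑ j ∈ Finset.range K, f (2 * j) + ∑ j ∈ Finset.range K, f (2 * j + 1) := by
  induction K with
  | zero => simp
  | succ K ih =>
    rw [Nat.mul_succ, Finset.sum_range_succ, Finset.sum_range_succ, ih, Finset.sum_range_succ,
      Finset.sum_range_succ _ K]
    abel

theorem sum_even_blocks {X : Type*} [AddCommMonoid X] {M B : ℕ → ℕ} (hM : Monotone M)
    (h0 : M 0 = 0) (hB : ∀ i k, B i = k ↔ M k ≤ i ∧ i < M (k + 1)) (f : ℕ → X) (K : ℕ) :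
    ∑ i ∈ (Finset.range (M (2 * K))).filter (fun i => Even (B i)), f i =
      ∑ j ∈ Finset.range K, ∑ i ∈ Finset.Ico (M (2 * j)) (M (2 * j + 1)), f i := by
  have hBk : ∀ k, ∀ i ∈ Finset.Ico (M k) (M (k + 1)), B i = k := fun k i hi =>
    (hB i k).2 (Finset.mem_Ico.1 hi)
  rw [Finset.sum_filter, sum_range_blocks hM h0, sum_range_two_mul_eq_add]
  have h1 : ∀ j, ∑ i ∈ Finset.Ico (M (2 * j)) (M (2 * j + 1)), (if Even (B i) then f i else 0) =
      ∑ i ∈ Finset.Ico (M (2 * j)) (M (2 * j + 1)), f i := fun j =>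
    Finset.sum_congr rfl fun i hi => by rw [hBk _ i hi, if_pos (even_two_mul j)]
  have h2 : ∀ j, ∑ i ∈ Finset.Ico (M (2 * j + 1)) (M (2 * j + 1 + 1)),
      (if Even (B i) then f i else 0) = 0 := fun j =>
    Finset.sum_eq_zero fun i hi => by
      rw [hBk _ i hi, if_neg (Nat.not_even_iff_odd.2 (odd_two_mul_add_one j))]
  simp only [h1, h2, Finset.sum_const_zero, add_zero]

end BlockSums

/-! ### Compactness and gliding hump: from basic sequences to uniform separation. -/

section Gliding

open Filter Topology

variable {𝕜 : Type*} [RCLike 𝕜] {X : Type*} [NormedAddCommGroup X] [NormedSpace 𝕜 X]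

/-- Gliding hump: if finitely supported vectors expanded in weavings `σs n` converge, together with
the weavings and their coefficients, then the parts of suitable members of the sequence beyond `M k`
can be glued to successive blocks of a single weaving `τ`. -/
theorem exists_glide {x : Fin 2 → ℕ → X} {σs : ℕ → ℕ → Fin 2} {σ : ℕ → Fin 2} {as : ℕ → ℕ → 𝕜}
    {a : ℕ → 𝕜} {N : ℕ → ℕ} {w : X} (hσ : ∀ i, ∀ᶠ n in atTop, σs n i = σ i)
    (ha : ∀ i, Tendsto (fun n => as n i) atTop (𝓝 (a i)))
    (hN : ∀ n i, N n ≤ i → as n i = 0)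
    (hw : Tendsto (fun n => ∑ i ∈ Finset.range (N n), as n i • x (σs n i) i) atTop (𝓝 w)) :
    ∃ (M n : ℕ → ℕ) (τ : ℕ → Fin 2) (c : ℕ → 𝕜), StrictMono M ∧ M 0 = 0 ∧ ∀ k,
      ∑ i ∈ Finset.range (M k), ‖as (n k) i - a i‖ * ‖x (σ i) i‖ ≤ (1 / 2 : ℝ) ^ k ∧
      ‖∑ i ∈ Finset.range (N (n k)), as (n k) i • x (σs (n k) i) i - w‖ ≤ (1 / 2 : ℝ) ^ k ∧
      ∀ F : Fin 2 → ℕ → X, ∑ i ∈ Finset.range (N (n k)), as (n k) i • F (σs (n k) i) i =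
        ∑ i ∈ Finset.range (M k), as (n k) i • F (σ i) i +
          ∑ i ∈ Finset.Ico (M k) (M (k + 1)), c i • F (τ i) i := by
  have hex : ∀ k m : ℕ, ∃ n,
      ∑ i ∈ Finset.range m, ‖as n i - a i‖ * ‖x (σ i) i‖ ≤ (1 / 2 : ℝ) ^ k ∧
      ‖∑ i ∈ Finset.range (N n), as n i • x (σs n i) i - w‖ ≤ (1 / 2 : ℝ) ^ k ∧
      ∀ i ∈ Finset.range m, σs n i = σ i := by
    intro k m
    have hk : (0 : ℝ) < (1 / 2) ^ k := by positivity
    have h1 : Tendsto (fun n => ∑ i ∈ Finset.range m, ‖as n i - a i‖ * ‖x (σ i) i‖) atTop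
        (𝓝 (∑ i ∈ Finset.range m, ‖a i - a i‖ * ‖x (σ i) i‖)) :=
      tendsto_finsetSum _ fun i _ => (((ha i).sub_const _).norm).mul_const _
    simp only [sub_self, norm_zero, zero_mul, Finset.sum_const_zero] at h1
    have h2 := (hw.sub_const w).norm
    rw [sub_self, norm_zero] at h2
    have h3 := (Finset.eventually_all (Finset.range m)).2 fun i _ => hσ i
    obtain ⟨n, h1, h2, h3⟩ :=
      ((h1.eventually_le_const hk).and ((h2.eventually_le_const hk).and h3)).exists
    exact ⟨n, h1, h2, h3⟩
  choose ν h1 h2 h3 using hex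
  -- The next block end lies past the support of the vector just chosen; `m + 1` keeps the sequence
  -- strictly increasing.
  let M : ℕ → ℕ := fun k => Nat.rec 0 (fun k m => max (m + 1) (N (ν k m))) k
  have hsucc : ∀ k, M (k + 1) = max (M k + 1) (N (ν k (M k))) := fun k => rfl
  have hM : StrictMono M := strictMono_nat_of_lt_succ fun k => by rw [hsucc]; omega
  obtain ⟨B, hB⟩ := exists_blockIndex hM rfl
  -- On block `k` both `τ` and `c` copy the `k`-th chosen vector. The splitting holds for every
  -- array `F`, so it can be read with `x` and with `weavingPart x 0`.
  refine ⟨M, fun k => ν k (M k), fun i => σs (ν (B i) (M (B i))) i,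
    fun i => as (ν (B i) (M (B i))) i, hM, rfl, fun k => ⟨h1 _ _, h2 _ _, fun F => ?_⟩⟩
  have hNM : N (ν k (M k)) ≤ M (k + 1) := by rw [hsucc]; omega
  have e1 : ∑ i ∈ Finset.range (N (ν k (M k))), as (ν k (M k)) i • F (σs (ν k (M k)) i) i =
      ∑ i ∈ Finset.range (M (k + 1)), as (ν k (M k)) i • F (σs (ν k (M k)) i) i :=
    Finset.sum_subset (Finset.range_mono hNM) fun i _ hi => by
      rw [hN _ _ (by simpa using hi), zero_smul]
  rw [e1, ← Finset.sum_range_add_sum_Ico _ (hM k.lt_succ_self).le]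
  congr 1
  · exact Finset.sum_congr rfl fun i hi => by rw [h3 k (M k) i hi]
  · exact Finset.sum_congr rfl fun i hi => by
      simp only [(hB i k).2 (Finset.mem_Ico.1 hi)]

/-- The deviations `w - ∑ i < M k, a i • x (σ i) i` have bounded sums along a subsequence. -/
theorem exists_bounded_sum_deviation {x : Fin 2 → ℕ → X} {σs : ℕ → ℕ → Fin 2} {σ : ℕ → Fin 2}
    {as : ℕ → ℕ → 𝕜} {a : ℕ → 𝕜} {N : ℕ → ℕ} {w : X} {R : ℝ}
    (hU : ∀ τ : ℕ → Fin 2, ∃ L, 0 ≤ L ∧ IsSuppressionUnconditional 𝕜 L (fun i => x (τ i) i))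
    (hσ : ∀ i, ∀ᶠ n in atTop, σs n i = σ i)
    (ha : ∀ i, Tendsto (fun n => as n i) atTop (𝓝 (a i)))
    (hN : ∀ n i, N n ≤ i → as n i = 0)
    (hw : Tendsto (fun n => ∑ i ∈ Finset.range (N n), as n i • x (σs n i) i) atTop (𝓝 w))
    (hR : ∀ n (s : Finset ℕ), ‖∑ i ∈ s, as n i • x (σs n i) i‖ ≤ R) :
    ∃ (B : ℝ) (M : ℕ → ℕ), StrictMono M ∧ ∀ K,
      ‖∑ k ∈ Finset.range (2 * K), (w - ∑ i ∈ Finset.range (M k), a i • x (σ i) i)‖ ≤ B := by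
  obtain ⟨M, n, τ, c, hM, hM0, h⟩ := exists_glide hσ ha hN hw
  obtain ⟨L, hL0, hL⟩ := hU τ
  obtain ⟨B, hB⟩ := exists_blockIndex hM hM0
  have hRlim : ∀ s : Finset ℕ, ‖∑ i ∈ s, a i • x (σ i) i‖ ≤ R := by
    intro s
    have ht : Tendsto (fun n => ∑ i ∈ s, as n i • x (σ i) i) atTop
        (𝓝 (∑ i ∈ s, a i • x (σ i) i)) := tendsto_finsetSum _ fun i _ => (ha i).smul_const _
    refine le_of_tendsto ht.norm ?_
    filter_upwards [(Finset.eventually_all s).2 fun i _ => hσ i] with n hn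
    have e : ∑ i ∈ s, as n i • x (σ i) i = ∑ i ∈ s, as n i • x (σs n i) i :=
      Finset.sum_congr rfl fun i hi => by rw [hn i hi]
    rw [e]
    exact hR n s
  set p : ℕ → X := fun k => ∑ i ∈ Finset.Ico (M k) (M (k + 1)), c i • x (τ i) i with hp
  set d : ℕ → X := fun k => w - ∑ i ∈ Finset.range (M k), a i • x (σ i) i with hd
  -- The tail `p k` is the chosen vector minus its head; the vector is close to `w` and the head to
  -- the limit partial sum, each within `(1 / 2) ^ k`.
  have hpd : ∀ k, ‖p k - d k‖ ≤ 2 * (1 / 2 : ℝ) ^ k := by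
    intro k
    obtain ⟨hk1, hk2, hk3⟩ := h k
    have e : p k - d k = (∑ i ∈ Finset.range (N (n k)), as (n k) i • x (σs (n k) i) i - w) -
        ∑ i ∈ Finset.range (M k), (as (n k) i - a i) • x (σ i) i := by
      rw [hk3 x]
      simp only [hp, hd, sub_smul, Finset.sum_sub_distrib]
      abel
    rw [e]
    refine (norm_sub_le _ _).trans ?_
    have : ‖∑ i ∈ Finset.range (M k), (as (n k) i - a i) • x (σ i) i‖ ≤ (1 / 2 : ℝ) ^ k :=
      (norm_sum_le _ _).trans (by simpa only [norm_smul] using hk1)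
    linarith
  refine ⟨(2 * L + 1) * (R + 4) + 4, M, hM, fun K => ?_⟩
  have hgeom : ∀ K : ℕ, ∑ k ∈ Finset.range K, ‖p k - d k‖ ≤ 4 := by
    intro K
    calc ∑ k ∈ Finset.range K, ‖p k - d k‖ ≤ ∑ k ∈ Finset.range K, 2 * (1 / 2 : ℝ) ^ k :=
          Finset.sum_le_sum fun k _ => hpd k
      _ = 2 * ∑ k ∈ Finset.range K, (1 / 2 : ℝ) ^ k := by rw [Finset.mul_sum]
      _ ≤ 4 := by linarith [sum_geometric_two_le K]
  set E := ∑ j ∈ Finset.range K, p (2 * j) with hE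
  set O := ∑ j ∈ Finset.range K, p (2 * j + 1) with hO
  -- In `d (2 * j) - d (2 * j + 1)` the vector `w` cancels and one block of the limit series
  -- remains.
  have hdiff : ‖∑ j ∈ Finset.range K, d (2 * j) - ∑ j ∈ Finset.range K, d (2 * j + 1)‖ ≤ R := by
    have : ∑ j ∈ Finset.range K, d (2 * j) - ∑ j ∈ Finset.range K, d (2 * j + 1) =
        ∑ i ∈ (Finset.range (M (2 * K))).filter (fun i => Even (B i)), a i • x (σ i) i := by
      rw [sum_even_blocks hM.monotone hM0 hB, ← Finset.sum_sub_distrib]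
      refine Finset.sum_congr rfl fun j _ => ?_
      rw [Finset.sum_Ico_eq_sub _ (hM.monotone (Nat.le_succ _))]
      simp only [hd]
      abel
    rw [this]
    exact hRlim _
  have hEO : ‖E - O‖ ≤ R + 4 := by
    have e : E - O = (∑ j ∈ Finset.range K, d (2 * j) - ∑ j ∈ Finset.range K, d (2 * j + 1)) +
        (∑ j ∈ Finset.range K, (p (2 * j) - d (2 * j)) -
          ∑ j ∈ Finset.range K, (p (2 * j + 1) - d (2 * j + 1))) := by
      simp only [Finset.sum_sub_distrib, hE, hO]
      abel
    have h1 := norm_sum_le (Finset.range K) fun j => p (2 * j) - d (2 * j)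
    have h2 := norm_sum_le (Finset.range K) fun j => p (2 * j + 1) - d (2 * j + 1)
    have h3 := hgeom (2 * K)
    rw [sum_range_two_mul_eq_add] at h3
    rw [e]
    refine (norm_add_le _ _).trans (add_le_add hdiff ((norm_sub_le _ _).trans ?_))
    linarith
  have hEn : ‖E‖ ≤ L * (R + 4) := by
    -- With alternating signs on the blocks of `τ` the full sum is `E - O`, and suppressing the odd
    -- blocks leaves `E`.
    have h1 := hL (fun i => (-1) ^ B i * c i)
      ((Finset.range (M (2 * K))).filter (fun i => Even (B i))) (Finset.range (M (2 * K)))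
      (Finset.filter_subset _ _)
    have hblock : ∀ k, ∑ i ∈ Finset.Ico (M k) (M (k + 1)), ((-1) ^ B i * c i) • x (τ i) i =
        ((-1) ^ k : 𝕜) • p k := by
      intro k
      rw [hp, Finset.smul_sum]
      refine Finset.sum_congr rfl fun i hi => ?_
      rw [(hB i k).2 (Finset.mem_Ico.1 hi), mul_smul]
    rw [sum_even_blocks hM.monotone hM0 hB, sum_range_blocks hM.monotone hM0] at h1
    simp only [hblock] at h1
    rw [sum_range_two_mul_eq_add] at h1
    simp only [even_two_mul, Even.neg_pow, one_pow, one_smul, pow_succ, neg_smul, mul_neg,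
      mul_one, Finset.sum_neg_distrib, ← sub_eq_add_neg] at h1
    exact h1.trans (mul_le_mul_of_nonneg_left hEO hL0)
  -- The unsigned sum is `E + O = 2E - (E - O)`, up to the summable errors.
  have hfin : ∑ k ∈ Finset.range (2 * K), d k =
      E + E - (E - O) - ∑ k ∈ Finset.range (2 * K), (p k - d k) := by
    have e : ∑ k ∈ Finset.range (2 * K), (p k - d k) =
        E + O - ∑ k ∈ Finset.range (2 * K), d k := by
      rw [Finset.sum_sub_distrib p d, sum_range_two_mul_eq_add p]
    rw [e]
    abel
  rw [hfin]
  have h1 := norm_sub_le (E + E - (E - O)) (∑ k ∈ Finset.range (2 * K), (p k - d k))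
  have h2 := norm_sub_le (E + E) (E - O)
  have h3 := norm_add_le E E
  have h4 := (norm_sum_le (Finset.range (2 * K)) fun k => p k - d k).trans (hgeom (2 * K))
  linarith

/-- Compactness of coefficients and weavings. -/
theorem exists_subseq_weaving {x : Fin 2 → ℕ → X} (hx : ∀ j i, x j i ≠ 0) {σs : ℕ → ℕ → Fin 2}
    {as : ℕ → ℕ → 𝕜} {R : ℝ}
    (hR : ∀ n (s : Finset ℕ), ‖∑ i ∈ s, as n i • x (σs n i) i‖ ≤ R) :
    ∃ (φ : ℕ → ℕ) (σ : ℕ → Fin 2) (a : ℕ → 𝕜), StrictMono φ ∧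
      (∀ i, ∀ᶠ n in atTop, σs (φ n) i = σ i) ∧
      ∀ i, Tendsto (fun n => as (φ n) i) atTop (𝓝 (a i)) := by
  have hR0 : 0 ≤ R := (norm_nonneg _).trans (hR 0 ∅)
  -- A bound on the `i`-th coefficient valid whichever of the two vectors carries it, so that
  -- coefficients and weavings lie in a compact product.
  let r : ℕ → ℝ := fun i => R * ‖x 0 i‖⁻¹ + R * ‖x 1 i‖⁻¹
  have hr : ∀ n i, ‖as n i‖ ≤ r i := by
    intro n i
    have h := hR n {i}
    rw [Finset.sum_singleton, norm_smul, ← le_div_iff₀ (norm_pos_iff.2 (hx _ _)),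
      div_eq_mul_inv] at h
    refine h.trans ?_
    rcases Fin.exists_fin_two.1 ⟨σs n i, rfl⟩ with h | h <;> rw [h]
    · exact le_add_of_nonneg_right (by positivity)
    · exact le_add_of_nonneg_left (by positivity)
  have hc : IsCompact (univ.pi fun i => Metric.closedBall (0 : 𝕜) (r i) ×ˢ (univ : Set (Fin 2))) :=
    isCompact_univ_pi fun i => (isCompact_closedBall _ _).prod isCompact_univ
  obtain ⟨q, -, φ, hφ, hlim⟩ := hc.tendsto_subseq (x := fun n i => (as n i, σs n i))
    fun n i _ => ⟨by simpa using hr n i, mem_univ _⟩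
  rw [tendsto_pi_nhds] at hlim
  refine ⟨φ, fun i => (q i).2, fun i => (q i).1, hφ, fun i => ?_, fun i => ?_⟩
  · have := ((continuous_snd.tendsto _).comp (hlim i))
    rw [nhds_discrete, tendsto_pure] at this
    exact this
  · exact (continuous_fst.tendsto _).comp (hlim i)

theorem eq_zero_of_forall_nat_mul_le {t B : ℝ} (ht : 0 ≤ t) (h : ∀ K : ℕ, K * t ≤ B) : t = 0 := by
  by_contra h0
  obtain ⟨K, hK⟩ := exists_nat_gt (B / t)
  rw [div_lt_iff₀ (lt_of_le_of_ne ht (Ne.symm h0))] at hK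
  exact (h K).not_gt hK

/-- The limit of vectors expanded in converging weavings is annihilated by every functional that
annihilates the limit weaving. -/
theorem dual_eq_zero_of_tendsto_weaving {x : Fin 2 → ℕ → X} {σs : ℕ → ℕ → Fin 2} {σ : ℕ → Fin 2}
    {as : ℕ → ℕ → 𝕜} {a : ℕ → 𝕜} {N : ℕ → ℕ} {w : X} {R : ℝ}
    (hU : ∀ τ : ℕ → Fin 2, ∃ L, 0 ≤ L ∧ IsSuppressionUnconditional 𝕜 L (fun i => x (τ i) i))
    (hσ : ∀ i, ∀ᶠ n in atTop, σs n i = σ i)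
    (ha : ∀ i, Tendsto (fun n => as n i) atTop (𝓝 (a i)))
    (hN : ∀ n i, N n ≤ i → as n i = 0)
    (hw : Tendsto (fun n => ∑ i ∈ Finset.range (N n), as n i • x (σs n i) i) atTop (𝓝 w))
    (hR : ∀ n (s : Finset ℕ), ‖∑ i ∈ s, as n i • x (σs n i) i‖ ≤ R)
    (g : StrongDual 𝕜 X) (hg : ∀ i, g (x (σ i) i) = 0) : g w = 0 := by
  obtain ⟨B, M, -, hB⟩ := exists_bounded_sum_deviation hU hσ ha hN hw hR
  rw [← norm_eq_zero]
  -- Every deviation has the same value `g w`, so a bounded sum of `2 * K` of them forces `g w = 0`.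
  refine eq_zero_of_forall_nat_mul_le (B := ‖g‖ * B) (norm_nonneg _) fun K => ?_
  have h1 := (g.le_opNorm _).trans (mul_le_mul_of_nonneg_left (hB K) (norm_nonneg g))
  simp only [map_sum, map_sub, map_smul, hg, smul_zero, Finset.sum_const_zero, sub_zero,
    Finset.sum_const, Finset.card_range, nsmul_eq_mul, norm_mul] at h1
  rw [RCLike.norm_natCast] at h1
  refine le_trans ?_ h1
  push_cast
  nlinarith [norm_nonneg (g w), (Nat.cast_nonneg K : (0 : ℝ) ≤ K)]

/-- If vectors expanded in converging weavings tend to zero, then so do their coefficients. -/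
theorem coeff_eq_zero_of_tendsto_weaving_zero {x : Fin 2 → ℕ → X} (hx : ∀ j i, x j i ≠ 0)
    {σs : ℕ → ℕ → Fin 2} {σ : ℕ → Fin 2} {as : ℕ → ℕ → 𝕜} {a : ℕ → 𝕜} {N : ℕ → ℕ} {R : ℝ}
    (hU : ∀ τ : ℕ → Fin 2, ∃ L, 0 ≤ L ∧ IsSuppressionUnconditional 𝕜 L (fun i => x (τ i) i))
    (hσ : ∀ i, ∀ᶠ n in atTop, σs n i = σ i)
    (ha : ∀ i, Tendsto (fun n => as n i) atTop (𝓝 (a i)))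
    (hN : ∀ n i, N n ≤ i → as n i = 0)
    (hw : Tendsto (fun n => ∑ i ∈ Finset.range (N n), as n i • x (σs n i) i) atTop (𝓝 0))
    (hR : ∀ n (s : Finset ℕ), ‖∑ i ∈ s, as n i • x (σs n i) i‖ ≤ R) (j : ℕ) : a j = 0 := by
  obtain ⟨B, M, hM, hB⟩ := exists_bounded_sum_deviation hU hσ ha hN hw hR
  obtain ⟨L, hL0, hL⟩ := hU σ
  have hxj := norm_pos_iff.2 (hx (σ j) j)
  suffices h : ‖a j‖ * ‖x (σ j) j‖ = 0 by
    simpa [hxj.ne'] using h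
  refine eq_zero_of_forall_nat_mul_le (B := L * B) (by positivity) fun K => ?_
  -- Since `k ≤ M k`, the `K` indices `k` in `[j + 1, Q)` all give partial sums containing the
  -- `j`-th term; `cnt` counts these occurrences.
  set Q := K + (j + 1) with hQ
  let cnt : ℕ → ℕ := fun i => ((Finset.range (2 * Q)).filter fun k => i < M k).card
  have hcnt : K ≤ cnt j := by
    have : Finset.Ico (j + 1) Q ⊆ (Finset.range (2 * Q)).filter fun k => j < M k := by
      intro k hk
      have := hM.le_apply (x := k)
      simp only [Finset.mem_Ico, Finset.mem_filter, Finset.mem_range] at hk ⊢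
      omega
    simpa [hQ] using Finset.card_le_card this
  have hsum : ∑ k ∈ Finset.range (2 * Q), ∑ i ∈ Finset.range (M k), a i • x (σ i) i =
      ∑ i ∈ Finset.range (M (2 * Q)), ((cnt i : 𝕜) * a i) • x (σ i) i := by
    have h1 : ∀ k ∈ Finset.range (2 * Q), ∑ i ∈ Finset.range (M k), a i • x (σ i) i =
        ∑ i ∈ Finset.range (M (2 * Q)), if i < M k then a i • x (σ i) i else 0 := by
      intro k hk
      have hle : M k ≤ M (2 * Q) := hM.monotone (Finset.mem_range.1 hk).le
      rw [← Finset.sum_filter]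
      refine Finset.sum_congr ?_ fun _ _ => rfl
      ext i
      simp only [Finset.mem_range, Finset.mem_filter]
      omega
    rw [Finset.sum_congr rfl h1, Finset.sum_comm]
    refine Finset.sum_congr rfl fun i _ => ?_
    rw [← Finset.sum_filter, Finset.sum_const, mul_smul, Nat.cast_smul_eq_nsmul]
  have h1 := hB Q
  simp only [zero_sub, Finset.sum_neg_distrib, norm_neg, hsum] at h1
  have hj : j ∈ Finset.range (M (2 * Q)) := by
    have := hM.le_apply (x := 2 * Q)
    rw [Finset.mem_range]
    omega
  have h2 := hL (fun i => (cnt i : 𝕜) * a i) {j} _ (Finset.singleton_subset_iff.2 hj)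
  rw [Finset.sum_singleton, norm_smul, norm_mul, RCLike.norm_natCast] at h2
  calc (K : ℝ) * (‖a j‖ * ‖x (σ j) j‖) ≤ cnt j * (‖a j‖ * ‖x (σ j) j‖) := by
        gcongr
    _ ≤ L * B := by
        rw [← mul_assoc]
        exact h2.trans (mul_le_mul_of_nonneg_left h1 hL0)

theorem IsSuppressionUnconditional.norm_sum_le {L : ℝ} {z : ℕ → X}
    (hz : IsSuppressionUnconditional 𝕜 L z) {a : ℕ → 𝕜} {N : ℕ} (ha : ∀ i, N ≤ i → a i = 0)
    (s : Finset ℕ) : ‖∑ i ∈ s, a i • z i‖ ≤ L * ‖∑ i ∈ Finset.range N, a i • z i‖ := by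
  have h := hz a s (s ∪ Finset.range N) Finset.subset_union_left
  rwa [← Finset.sum_subset (Finset.subset_union_right (s₁ := s) (s₂ := Finset.range N))
    fun i _ hi => by rw [ha i (by simpa using hi), zero_smul]] at h

/-- The terms with index `j` of a weaving. -/
def weavingPart (x : Fin 2 → ℕ → X) (j : Fin 2) (l : Fin 2) (i : ℕ) : X :=
  if l = j then x j i else 0

theorem smul_weavingPart (x : Fin 2 → ℕ → X) (j l : Fin 2) (i : ℕ) (c : 𝕜) :
    c • weavingPart x j l i = (if l = j then c else 0) • x j i := by
  unfold weavingPart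
  split_ifs <;> simp

theorem sum_weavingPart_add (x : Fin 2 → ℕ → X) (σ : ℕ → Fin 2) (a : ℕ → 𝕜) (s : Finset ℕ) :
    ∑ i ∈ s, a i • weavingPart x 0 (σ i) i + ∑ i ∈ s, a i • weavingPart x 1 (σ i) i =
      ∑ i ∈ s, a i • x (σ i) i := by
  rw [← Finset.sum_add_distrib]
  refine Finset.sum_congr rfl fun i _ => ?_
  rw [← smul_add]
  congr 1
  rcases Fin.exists_fin_two.1 ⟨σ i, rfl⟩ with h | h <;> simp [weavingPart, h]

/-- Each part is a combination of a single sequence, where suppression costs the factor `L`. The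
second part is the whole minus the first, which accounts for the factor `2`. -/
theorem norm_sum_weaving_le {x : Fin 2 → ℕ → X} {L : ℝ}
    (hL : ∀ j, IsSuppressionUnconditional 𝕜 L (x j)) (hL0 : 0 ≤ L) (σ : ℕ → Fin 2) (a : ℕ → 𝕜)
    {s t : Finset ℕ} (hst : s ⊆ t) : ‖∑ i ∈ s, a i • x (σ i) i‖ ≤
      L * (2 * ‖∑ i ∈ t, a i • weavingPart x 0 (σ i) i‖ + ‖∑ i ∈ t, a i • x (σ i) i‖) := by
  have h : ∀ j, ‖∑ i ∈ s, a i • weavingPart x j (σ i) i‖ ≤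
      L * ‖∑ i ∈ t, a i • weavingPart x j (σ i) i‖ := by
    intro j
    simp only [smul_weavingPart]
    exact hL j _ s t hst
  have h1 : ‖∑ i ∈ t, a i • weavingPart x 1 (σ i) i‖ ≤
      ‖∑ i ∈ t, a i • x (σ i) i‖ + ‖∑ i ∈ t, a i • weavingPart x 0 (σ i) i‖ := by
    rw [← sum_weavingPart_add x σ a t, add_comm (∑ i ∈ t, a i • weavingPart x 0 (σ i) i)]
    exact norm_le_add_norm_add _ _
  rw [← sum_weavingPart_add x σ a s]
  refine (norm_add_le _ _).trans ((add_le_add (h 0) (h 1)).trans ?_)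
  rw [← mul_add]
  exact mul_le_mul_of_nonneg_left (by linarith) hL0

/-- If every weaving is an unconditional basic sequence then the two parts of the weavings are
uniformly separated. -/
theorem exists_norm_weavingPart_le {x : Fin 2 → ℕ → X} (hx : ∀ j i, x j i ≠ 0)
    (hU : ∀ τ : ℕ → Fin 2, ∃ L, 0 ≤ L ∧ IsSuppressionUnconditional 𝕜 L (fun i => x (τ i) i)) :
    ∃ D : ℝ, 0 ≤ D ∧ ∀ (σ : ℕ → Fin 2) (a : ℕ → 𝕜) (s : Finset ℕ),
      ‖∑ i ∈ s, a i • weavingPart x 0 (σ i) i‖ ≤ D * ‖∑ i ∈ s, a i • x (σ i) i‖ := by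
  classical
  by_contra! hcon
  have hseq : ∀ n : ℕ, ∃ (σ : ℕ → Fin 2) (a : ℕ → 𝕜) (N : ℕ), (∀ i, N ≤ i → a i = 0) ∧
      ‖∑ i ∈ Finset.range N, a i • weavingPart x 0 (σ i) i‖ = 1 ∧
      ‖∑ i ∈ Finset.range N, a i • x (σ i) i‖ ≤ 1 / ((n : ℝ) + 1) := by
    intro n
    obtain ⟨σ, a, s, h⟩ := hcon (n + 1) (by positivity)
    set u := ∑ i ∈ s, a i • weavingPart x 0 (σ i) i with hu
    have hu0 : 0 < ‖u‖ := lt_of_le_of_lt (by positivity) h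
    let a' : ℕ → 𝕜 := fun i => if i ∈ s then (‖u‖⁻¹ : ℝ) * a i else 0
    have hs : s ⊆ Finset.range (s.sup id + 1) := fun i hi => by
      have : i ≤ s.sup id := Finset.le_sup (f := id) hi
      rw [Finset.mem_range]
      omega
    have hsum : ∀ G : ℕ → X, ∑ i ∈ Finset.range (s.sup id + 1), a' i • G i =
        ((‖u‖⁻¹ : ℝ) : 𝕜) • ∑ i ∈ s, a i • G i := by
      intro G
      rw [← Finset.sum_subset hs fun i _ hi => by simp [a', hi], Finset.smul_sum]
      exact Finset.sum_congr rfl fun i hi => by simp only [a', if_pos hi, mul_smul]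
    refine ⟨σ, a', s.sup id + 1, fun i hi => ?_, ?_, ?_⟩
    · exact if_neg fun his => by have := Finset.mem_range.1 (hs his); omega
    · rw [hsum, norm_smul, ← hu, RCLike.norm_ofReal, abs_of_pos (inv_pos.2 hu0),
        inv_mul_cancel₀ hu0.ne']
    · rw [hsum, norm_smul, RCLike.norm_ofReal, abs_of_pos (inv_pos.2 hu0),
        inv_mul_le_iff₀ hu0, mul_one_div, le_div_iff₀ (by positivity)]
      linarith
  choose σs as N hN hu hw using hseq
  obtain ⟨L₀, hL₀0, hL₀⟩ := hU fun _ => 0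
  obtain ⟨L₁, hL₁0, hL₁⟩ := hU fun _ => 1
  have hmono : ∀ {L L' : ℝ} {z : ℕ → X}, L ≤ L' → IsSuppressionUnconditional 𝕜 L z →
      IsSuppressionUnconditional 𝕜 L' z := fun h hz a s t hst =>
    (hz a s t hst).trans (mul_le_mul_of_nonneg_right h (norm_nonneg _))
  have hLj : ∀ j, IsSuppressionUnconditional 𝕜 (L₀ + L₁) (x j) := by
    intro j
    rcases Fin.exists_fin_two.1 ⟨j, rfl⟩ with h | h <;> rw [h]
    · exact hmono (by linarith) hL₀
    · exact hmono (by linarith) hL₁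
  have hR : ∀ n (s : Finset ℕ), ‖∑ i ∈ s, as n i • x (σs n i) i‖ ≤ (L₀ + L₁) * 3 := by
    intro n s
    have h := norm_sum_weaving_le hLj (by positivity) (σs n) (as n)
      (Finset.subset_union_left (s₁ := s) (s₂ := Finset.range (N n)))
    have hext : ∀ G : ℕ → X, ∑ i ∈ s ∪ Finset.range (N n), as n i • G i =
        ∑ i ∈ Finset.range (N n), as n i • G i := fun G =>
      (Finset.sum_subset Finset.subset_union_right fun i _ hi => by
        rw [hN n i (by simpa using hi), zero_smul]).symm
    rw [hext, hext, hu] at h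
    refine h.trans (mul_le_mul_of_nonneg_left ?_ (by positivity))
    have h1 : 1 / ((n : ℝ) + 1) ≤ 1 :=
      (div_le_one (by positivity)).2 (by linarith [n.cast_nonneg (α := ℝ)])
    linarith [hw n]
  obtain ⟨φ, σ, a, hφ, hσ, ha⟩ := exists_subseq_weaving hx hR
  have hw0 : Tendsto (fun n => ∑ i ∈ Finset.range (N (φ n)), as (φ n) i • x (σs (φ n) i) i) atTop
      (𝓝 0) :=
    (squeeze_zero_norm hw tendsto_one_div_add_atTop_nhds_zero_nat).comp hφ.tendsto_atTop
  -- With zero limit coefficients the heads become negligible and all the mass sits in the tails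
  -- that are glued into `τ`.
  have ha0 := coeff_eq_zero_of_tendsto_weaving_zero hx hU hσ ha (fun n => hN (φ n)) hw0
    (fun n => hR (φ n))
  obtain ⟨M, n, τ, c, hM, hM0, h⟩ := exists_glide hσ ha (fun n => hN (φ n)) hw0
  obtain ⟨L, hL0, hL⟩ := hU τ
  have hpart : ∀ l i, ‖weavingPart x 0 l i‖ ≤ ‖x l i‖ := fun l i => by
    unfold weavingPart
    split_ifs with h
    · rw [h]
    · simp
  -- The unit vector is a head of norm at most `(1 / 2) ^ k` plus `q`, the sum `p` with the terms `τ
  -- i ≠ 0` suppressed; and `p`, a small vector minus a small head, has norm at most `2 * (1 / 2) ^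
  -- k`.
  have hk : ∀ k, (1 : ℝ) ≤ (1 + 2 * L) * (1 / 2) ^ k := by
    intro k
    obtain ⟨h1, h2, h3⟩ := h k
    simp only [ha0, sub_zero] at h1 h2
    have e0 := h3 (weavingPart x 0)
    have e1 := h3 x
    set p := ∑ i ∈ Finset.Ico (M k) (M (k + 1)), c i • x (τ i) i
    set q := ∑ i ∈ Finset.Ico (M k) (M (k + 1)), c i • weavingPart x 0 (τ i) i with hq
    have hqp : ‖q‖ ≤ L * ‖p‖ := by
      have h := hL c ((Finset.Ico (M k) (M (k + 1))).filter fun i => τ i = 0) _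
        (Finset.filter_subset _ _)
      have e : q = ∑ i ∈ (Finset.Ico (M k) (M (k + 1))).filter (fun i => τ i = 0),
          c i • x (τ i) i := by
        rw [hq, Finset.sum_filter]
        refine Finset.sum_congr rfl fun i _ => ?_
        unfold weavingPart
        split_ifs with h
        · rw [h]
        · simp
      rw [e]
      exact h
    have hu1 := hu (φ (n k))
    rw [e0] at hu1
    rw [e1] at h2
    have b0 : ‖∑ i ∈ Finset.range (M k), as (φ (n k)) i • weavingPart x 0 (σ i) i‖ ≤
        (1 / 2 : ℝ) ^ k :=
      ((norm_sum_le _ _).trans (Finset.sum_le_sum fun i _ => by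
        rw [norm_smul]
        exact mul_le_mul_of_nonneg_left (hpart _ _) (norm_nonneg _))).trans h1
    have b1 : ‖∑ i ∈ Finset.range (M k), as (φ (n k)) i • x (σ i) i‖ ≤ (1 / 2 : ℝ) ^ k :=
      ((norm_sum_le _ _).trans (Finset.sum_le_sum fun i _ => by rw [norm_smul])).trans h1
    have b2 : ‖p‖ ≤ 2 * (1 / 2 : ℝ) ^ k := by
      have := norm_le_add_norm_add p (∑ i ∈ Finset.range (M k), as (φ (n k)) i • x (σ i) i)
      rw [add_comm p] at this
      linarith
    have b3 := norm_add_le (∑ i ∈ Finset.range (M k), as (φ (n k)) i • weavingPart x 0 (σ i) i) q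
    rw [hu1] at b3
    nlinarith
  have hlim : Tendsto (fun k : ℕ => (1 + 2 * L) * (1 / 2 : ℝ) ^ k) atTop (𝓝 ((1 + 2 * L) * 0)) :=
    (tendsto_pow_atTop_nhds_zero_of_lt_one (by norm_num) (by norm_num)).const_mul _
  rw [mul_zero] at hlim
  exact absurd (ge_of_tendsto' hlim hk) (by norm_num)

end Gliding

/-! ### Completeness of the weavings. -/

section Density

open Filter Topology

variable {𝕜 : Type*} [RCLike 𝕜] {X : Type*} [NormedAddCommGroup X] [NormedSpace 𝕜 X]

/-- Hahn–Banach in the quotient by the closed span. In this dual form density can be tested on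
limits of weavings. -/
theorem dense_span_range_iff {z : ℕ → X} :
    Dense (Submodule.span 𝕜 (range z) : Set X) ↔
      ∀ g : StrongDual 𝕜 X, (∀ i, g (z i) = 0) → g = 0 := by
  constructor
  · intro hd g hg
    have h0 : ∀ v ∈ Submodule.span 𝕜 (range z), g v = 0 := by
      intro v hv
      have : Submodule.span 𝕜 (range z) ≤ (g : X →ₗ[𝕜] 𝕜).ker :=
        Submodule.span_le.2 (by rintro _ ⟨i, rfl⟩; exact hg i)
      exact this hv
    ext y
    exact hd.induction (P := fun y => g y = 0) h0 (isClosed_eq (by fun_prop) (by fun_prop)) y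
  · intro h
    by_contra hd
    let H := (Submodule.span 𝕜 (range z)).topologicalClosure
    have : IsClosed (H : Set X) := Submodule.isClosed_topologicalClosure _
    obtain ⟨y, hy⟩ : ∃ y, y ∉ H := by
      by_contra! hall
      exact hd fun y => hall y
    have hy0 : (H.mkQ y) ≠ 0 := by simpa using hy
    obtain ⟨g, -, hg⟩ := exists_dual_vector 𝕜 (H.mkQ y) (norm_ne_zero_iff.2 hy0)
    let q : X →L[𝕜] X ⧸ H := H.mkQ.mkContinuous 1 fun v => by
      simpa using Submodule.Quotient.norm_mk_le H v
    have hz : ∀ i, (g.comp q) (z i) = 0 := fun i => by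
      have : H.mkQ (z i) = 0 := (Submodule.Quotient.mk_eq_zero _).2
        (Submodule.le_topologicalClosure _ (Submodule.subset_span (mem_range_self i)))
      change g (H.mkQ (z i)) = 0
      rw [this, map_zero]
    have h1 : g (H.mkQ y) = 0 := by
      change (g.comp q) y = 0
      rw [h _ hz]
      rfl
    rw [hg] at h1
    exact hy0 (norm_eq_zero.1 (by exact_mod_cast h1))

/-- Exchanging one vector of an unconditional basis for one that is separated from the others
preserves density of the span. -/
theorem dense_span_update [CompleteSpace X] {L L' : ℝ} {z : ℕ → X} {y : X} (j : ℕ)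
    (hz : IsSuppressionUnconditional 𝕜 L z) (hz0 : ∀ i, z i ≠ 0)
    (hd : Dense (Submodule.span 𝕜 (range z) : Set X)) (hy : y ≠ 0)
    (hz' : IsSuppressionUnconditional 𝕜 L' (Function.update z j y)) :
    Dense (Submodule.span 𝕜 (range (Function.update z j y)) : Set X) := by
  obtain ⟨b, hbz, -⟩ := hz.exists_basis hz0 hd
  have hexp : Tendsto (fun n => ∑ i ∈ Finset.range n, b.coord i y • z i) atTop (𝓝 y) := by
    simpa only [hbz] using (seriesTo_iff _ _).1 (b.expansion y)
  -- Otherwise `y` is a limit of combinations of the `z i` with `i ≠ j`, and suppressing all terms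
  -- but `y` in the exchanged sequence forces `y = 0`.
  have hcj : b.coord j y ≠ 0 := by
    intro hcj
    have hle : ∀ n, j < n → ‖y‖ ≤ L' * ‖y - ∑ i ∈ Finset.range n, b.coord i y • z i‖ := by
      intro n hn
      have h := hz' (Function.update (fun i => -b.coord i y) j 1) {j} (Finset.range n)
        (by simpa using hn)
      rw [Finset.sum_singleton, Function.update_self, Function.update_self, one_smul] at h
      have e : ∑ i ∈ Finset.range n, Function.update (fun i => -b.coord i y) j 1 i •
          Function.update z j y i = y - ∑ i ∈ Finset.range n, b.coord i y • z i := by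
        have hj : j ∈ Finset.range n := by simpa using hn
        rw [← Finset.add_sum_erase _ _ hj, ← Finset.add_sum_erase _ (fun i => b.coord i y • z i) hj,
          hcj, zero_smul, zero_add, Function.update_self, Function.update_self, one_smul,
          sub_eq_add_neg, ← Finset.sum_neg_distrib]
        congr 1
        refine Finset.sum_congr rfl fun i hi => ?_
        rw [Function.update_of_ne (Finset.ne_of_mem_erase hi),
          Function.update_of_ne (Finset.ne_of_mem_erase hi), neg_smul]
      rwa [e] at h
    have hlim : Tendsto (fun n => L' * ‖y - ∑ i ∈ Finset.range n, b.coord i y • z i‖) atTop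
        (𝓝 (L' * ‖y - y‖)) := ((hexp.const_sub y).norm).const_mul _
    rw [sub_self, norm_zero, mul_zero] at hlim
    have := ge_of_tendsto hlim ((eventually_gt_atTop j).mono hle)
    exact hy (norm_le_zero_iff.1 this)
  rw [dense_span_range_iff] at hd ⊢
  intro g hg
  refine hd g fun i => ?_
  have hne : ∀ i, i ≠ j → g (z i) = 0 := fun i hi => by
    simpa [Function.update_of_ne hi] using hg i
  by_cases hi : i = j
  · subst hi
    -- Applying `g` to the expansion of `y` leaves only the `j`-th term, so `g y = 0` and the
    -- nonzero coordinate give `g (z j) = 0`.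
    have h1 := (g.continuous.tendsto y).comp hexp
    have h2 : Tendsto (g ∘ fun n => ∑ k ∈ Finset.range n, b.coord k y • z k) atTop
        (𝓝 (b.coord i y * g (z i))) := by
      refine tendsto_const_nhds.congr' ((eventually_gt_atTop i).mono fun n hn => ?_)
      simp only [Function.comp, map_sum, map_smul, smul_eq_mul]
      rw [Finset.sum_eq_single i (fun k _ hk => by rw [hne k hk, mul_zero])
        fun h => absurd (Finset.mem_range.2 hn) h]
    have h3 := tendsto_nhds_unique h1 h2
    have h4 : g y = 0 := by simpa using hg i
    rw [h4] at h3
    exact (mul_eq_zero.1 h3.symm).resolve_left hcj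
  · exact hne i hi

/-- If the weavings are uniformly unconditional and the first sequence has dense span, then so does
every weaving. -/
theorem dense_span_weaving [CompleteSpace X] {x : Fin 2 → ℕ → X} (hx : ∀ j i, x j i ≠ 0) {L : ℝ}
    (hL0 : 0 ≤ L) (hL : ∀ τ : ℕ → Fin 2, IsSuppressionUnconditional 𝕜 L (fun i => x (τ i) i))
    (hd : Dense (Submodule.span 𝕜 (range (x 0)) : Set X)) (σ : ℕ → Fin 2) :
    Dense (Submodule.span 𝕜 (range fun i => x (σ i) i) : Set X) := by
  have hfin : ∀ (n : ℕ) (τ : ℕ → Fin 2), (∀ i, n ≤ i → τ i = 0) →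
      Dense (Submodule.span 𝕜 (range fun i => x (τ i) i) : Set X) := by
    intro n
    induction n with
    | zero =>
      intro τ hτ
      simp only [fun i => hτ i i.zero_le]
      exact hd
    | succ n ih =>
      intro τ hτ
      have h0 := ih (Function.update τ n 0) fun i hi => by
        by_cases hin : i = n
        · rw [hin, Function.update_self]
        · rw [Function.update_of_ne hin, hτ i (by omega)]
      have e : (fun i => x (τ i) i) =
          Function.update (fun i => x (Function.update τ n 0 i) i) n (x (τ n) n) := by
        funext i
        by_cases hin : i = n
        · rw [hin, Function.update_self]
        · rw [Function.update_of_ne hin, Function.update_of_ne hin]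
      have hu := hL τ
      rw [e] at hu ⊢
      exact dense_span_update n (hL _) (fun i => hx _ _) h0 (hx _ _) hu
  rw [dense_span_range_iff]
  intro g hg
  ext w
  -- Finite exchanges converging to `σ`; each has dense span, so `w` is approximated in each of
  -- them.
  let σs : ℕ → ℕ → Fin 2 := fun n i => if i < n then σ i else 0
  have hseq : ∀ n : ℕ, ∃ (a : ℕ → 𝕜) (N : ℕ), (∀ i, N ≤ i → a i = 0) ∧
      ‖∑ i ∈ Finset.range N, a i • x (σs n i) i - w‖ ≤ 1 / ((n : ℝ) + 1) := by
    intro n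
    obtain ⟨v, hv, hwv⟩ := Metric.mem_closure_iff.1
      (hfin n (σs n) (fun i hi => if_neg (not_lt.2 hi)) w) (1 / ((n : ℝ) + 1)) (by positivity)
    obtain ⟨l, rfl⟩ := (Finsupp.mem_span_range_iff_exists_finsupp).1 hv
    have hsupp : l.support ⊆ Finset.range (l.support.sup id + 1) := fun i hi => by
      have : i ≤ l.support.sup id := Finset.le_sup (f := id) hi
      rw [Finset.mem_range]
      omega
    refine ⟨l, l.support.sup id + 1, fun i hi => ?_, ?_⟩
    · by_contra hne
      have := Finset.mem_range.1 (hsupp (Finsupp.mem_support_iff.2 hne))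
      omega
    · rw [← Finsupp.sum_of_support_subset l hsupp (fun i a => a • x (σs n i) i) (by simp),
        ← dist_eq_norm, dist_comm]
      exact hwv.le
  choose as N hN hw using hseq
  have hw0 : Tendsto (fun n => ∑ i ∈ Finset.range (N n), as n i • x (σs n i) i) atTop (𝓝 w) := by
    rw [tendsto_iff_norm_sub_tendsto_zero]
    exact squeeze_zero (fun _ => norm_nonneg _) hw tendsto_one_div_add_atTop_nhds_zero_nat
  have hR : ∀ n (s : Finset ℕ), ‖∑ i ∈ s, as n i • x (σs n i) i‖ ≤ L * (1 + ‖w‖) := by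
    intro n s
    refine ((hL (σs n)).norm_sum_le (hN n) s).trans (mul_le_mul_of_nonneg_left ?_ hL0)
    have h1 : 1 / ((n : ℝ) + 1) ≤ 1 :=
      (div_le_one (by positivity)).2 (by linarith [n.cast_nonneg (α := ℝ)])
    have h2 := norm_le_norm_sub_add (∑ i ∈ Finset.range (N n), as n i • x (σs n i) i) w
    linarith [hw n]
  obtain ⟨φ, τ, a, hφ, hτ, ha⟩ := exists_subseq_weaving hx hR
  -- The limit weaving supplied by compactness is the prescribed one.
  have hτσ : ∀ i, τ i = σ i := by
    intro i
    obtain ⟨n, hn, hin⟩ := ((hτ i).and (eventually_gt_atTop i)).exists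
    rw [← hn]
    exact if_pos (hin.trans_le hφ.le_apply)
  exact dual_eq_zero_of_tendsto_weaving (fun τ => ⟨L, hL0, hL τ⟩) hτ ha (fun n => hN (φ n))
    (hw0.comp hφ.tendsto_atTop) (fun n => hR (φ n)) g fun i => by rw [hτσ]; exact hg i

end Density

/-! ### Separation of the parts, suppression constants and subspace distance. -/

section Separation

variable {𝕜 : Type*} [RCLike 𝕜] {X : Type*} [NormedAddCommGroup X] [NormedSpace 𝕜 X]

variable (𝕜) in
/-- The closed spans of the two parts of the weaving with pattern `Γ` are separated, with
constant `D`. -/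
def IsSeparated (D : ℝ) (x y : ℕ → X) (Γ : Set ℕ) : Prop :=
  ∀ u ∈ closedSpan 𝕜 x Γ, ∀ v ∈ closedSpan 𝕜 y Γᶜ, ‖u‖ ≤ D * ‖u - v‖

theorem IsSeparated.symm {D : ℝ} {x y : ℕ → X} {Γ : Set ℕ} (h : IsSeparated 𝕜 D x y Γ) :
    IsSeparated 𝕜 (D + 1) y x Γᶜ := by
  intro v hv u hu
  rw [compl_compl] at hu
  have h1 := h u hu v hv
  have h2 := norm_le_norm_sub_add v u
  rw [norm_sub_rev u v] at h1
  linarith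

theorem closedSpan_le {x : ℕ → X} {Γ : Set ℕ} {S : Submodule 𝕜 X} (hS : IsClosed (S : Set X))
    (h : ∀ i ∈ Γ, x i ∈ S) : closedSpan 𝕜 x Γ ≤ S :=
  Submodule.topologicalClosure_minimal _
    (Submodule.span_le.2 (by rintro _ ⟨i, hi, rfl⟩; exact h i hi)) hS

theorem closedSpan_congr {x y : ℕ → X} {Γ : Set ℕ} (h : ∀ i ∈ Γ, x i = y i) :
    closedSpan 𝕜 x Γ = closedSpan 𝕜 y Γ := by
  rw [closedSpan, closedSpan, image_congr h]

theorem isClosed_closedSpan (x : ℕ → X) (Γ : Set ℕ) : IsClosed (closedSpan 𝕜 x Γ : Set X) :=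
  Submodule.isClosed_topologicalClosure _

theorem preimage_one_eq_compl (σ : ℕ → Fin 2) : σ ⁻¹' {1} = (σ ⁻¹' {0})ᶜ := by
  ext i
  rcases Fin.exists_fin_two.1 ⟨σ i, rfl⟩ with h | h <;> simp [h]

theorem isSeparated_of_norm_weavingPart_le {x : Fin 2 → ℕ → X} {σ : ℕ → Fin 2} {D : ℝ}
    (h : ∀ (a : ℕ → 𝕜) (s : Finset ℕ),
      ‖∑ i ∈ s, a i • weavingPart x 0 (σ i) i‖ ≤ D * ‖∑ i ∈ s, a i • x (σ i) i‖) :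
    IsSeparated 𝕜 D (x 0) (x 1) (σ ⁻¹' {0}) := by
  classical
  have hspan : ∀ u ∈ Submodule.span 𝕜 (x 0 '' (σ ⁻¹' {0})),
      ∀ v ∈ Submodule.span 𝕜 (x 1 '' (σ ⁻¹' {0})ᶜ), ‖u‖ ≤ D * ‖u - v‖ := by
    intro u hu v hv
    obtain ⟨l, hl, rfl⟩ := (Finsupp.mem_span_image_iff_linearCombination 𝕜).1 hu
    obtain ⟨m, hm, rfl⟩ := (Finsupp.mem_span_image_iff_linearCombination 𝕜).1 hv
    have hl0 : ∀ i, σ i ≠ 0 → l i = 0 := fun i hi => by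
      by_contra hne
      exact hi (hl (Finsupp.mem_support_iff.2 hne))
    have hm0 : ∀ i, σ i = 0 → m i = 0 := fun i hi => by
      by_contra hne
      exact hm (Finsupp.mem_support_iff.2 hne) hi
    set s := l.support ∪ m.support with hs
    rw [Finsupp.linearCombination_apply, Finsupp.linearCombination_apply,
      Finsupp.sum_of_support_subset l (Finset.subset_union_left (s₂ := m.support)) _ (by simp),
      Finsupp.sum_of_support_subset m (Finset.subset_union_right (s₁ := l.support)) _ (by simp),
      ← hs]
    -- The supports of `l` and `m` lie in complementary sets, so `l - m` is one coefficient sequence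
    -- for the weaving.
    have e0 : ∑ i ∈ s, (l i - m i) • weavingPart x 0 (σ i) i = ∑ i ∈ s, l i • x 0 i := by
      refine Finset.sum_congr rfl fun i _ => ?_
      by_cases hi : σ i = 0
      · simp [weavingPart, hi, hm0 i hi]
      · simp [weavingPart, hi, hl0 i hi]
    have e1 : ∑ i ∈ s, (l i - m i) • x (σ i) i = ∑ i ∈ s, l i • x 0 i - ∑ i ∈ s, m i • x 1 i := by
      rw [← Finset.sum_sub_distrib]
      refine Finset.sum_congr rfl fun i _ => ?_
      rcases Fin.exists_fin_two.1 ⟨σ i, rfl⟩ with hi | hi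
      · simp [hi, hm0 i hi]
      · simp [hi, hl0 i (by simp [hi])]
    rw [← e1, ← e0]
    exact h _ s
  -- The inequality is closed in each variable and passes to the closures one variable at a time.
  have h1 : ∀ u ∈ Submodule.span 𝕜 (x 0 '' (σ ⁻¹' {0})),
      ∀ v ∈ closedSpan 𝕜 (x 1) (σ ⁻¹' {0})ᶜ, ‖u‖ ≤ D * ‖u - v‖ := fun u hu =>
    closure_minimal (t := {v | ‖u‖ ≤ D * ‖u - v‖}) (hspan u hu)
      (isClosed_le (by fun_prop) (by fun_prop))
  exact fun u hu v hv => closure_minimal (t := {u | ‖u‖ ≤ D * ‖u - v‖}) (fun u hu => h1 u hu v hv)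
    (isClosed_le (by fun_prop) (by fun_prop)) hu

theorem IsSeparated.norm_weavingPart_le {x : Fin 2 → ℕ → X} {σ : ℕ → Fin 2} {D : ℝ}
    (h : IsSeparated 𝕜 D (x 0) (x 1) (σ ⁻¹' {0})) (a : ℕ → 𝕜) (s : Finset ℕ) :
    ‖∑ i ∈ s, a i • weavingPart x 0 (σ i) i‖ ≤ D * ‖∑ i ∈ s, a i • x (σ i) i‖ := by
  have h0 : ∑ i ∈ s, a i • weavingPart x 0 (σ i) i ∈ closedSpan 𝕜 (x 0) (σ ⁻¹' {0}) := by
    refine Submodule.sum_mem _ fun i _ => Submodule.smul_mem _ _ ?_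
    unfold weavingPart
    split_ifs with hi
    · exact mem_closedSpan 𝕜 (x 0) hi
    · exact Submodule.zero_mem _
  have h1 : ∑ i ∈ s, a i • weavingPart x 1 (σ i) i ∈ closedSpan 𝕜 (x 1) (σ ⁻¹' {0})ᶜ := by
    rw [← preimage_one_eq_compl]
    refine Submodule.sum_mem _ fun i _ => Submodule.smul_mem _ _ ?_
    unfold weavingPart
    split_ifs with hi
    · exact mem_closedSpan 𝕜 (x 1) hi
    · exact Submodule.zero_mem _
  have := h _ h0 _ (Submodule.neg_mem _ h1)
  rwa [sub_neg_eq_add, sum_weavingPart_add] at this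

/-- Weavings of separated unconditional sequences are unconditional. -/
theorem IsSeparated.isSuppressionUnconditional {x : Fin 2 → ℕ → X} {σ : ℕ → Fin 2} {D L : ℝ}
    (h : IsSeparated 𝕜 D (x 0) (x 1) (σ ⁻¹' {0})) (hL0 : 0 ≤ L)
    (hL : ∀ j, IsSuppressionUnconditional 𝕜 L (x j)) :
    IsSuppressionUnconditional 𝕜 (L * (2 * D + 1)) (fun i => x (σ i) i) := by
  intro a s t hst
  refine (norm_sum_weaving_le hL hL0 σ a hst).trans ?_
  rw [mul_assoc]
  refine mul_le_mul_of_nonneg_left ?_ hL0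
  linarith [h.norm_weavingPart_le a t]

theorem IsSeparated.inv_le_subspaceDist {x y : ℕ → X} {Γ : Set ℕ} {D : ℝ} (hD : 0 ≤ D)
    (h : IsSeparated 𝕜 D x y Γ) (hx : ∀ i, x i ≠ 0) (hy : ∀ i, y i ≠ 0) :
    (D + 1)⁻¹ ≤ subspaceDist (closedSpan 𝕜 x Γ) (closedSpan 𝕜 y Γᶜ) := by
  refine le_csInf ?_ ?_
  · have hunit : ∀ v : X, v ≠ 0 → ‖((‖v‖⁻¹ : ℝ) : 𝕜) • v‖ = 1 := fun v hv => by
      rw [norm_smul, RCLike.norm_ofReal, abs_of_nonneg (by positivity),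
        inv_mul_cancel₀ (norm_ne_zero_iff.2 hv)]
    by_cases h0 : 0 ∈ Γ
    · exact ⟨_, _, 0, Or.inl ⟨Submodule.smul_mem _ _ (mem_closedSpan 𝕜 x h0),
        Submodule.zero_mem _⟩, hunit _ (hx 0), rfl⟩
    · exact ⟨_, _, 0, Or.inr ⟨Submodule.smul_mem _ _ (mem_closedSpan 𝕜 y h0),
        Submodule.zero_mem _⟩, hunit _ (hy 0), rfl⟩
  · rintro _ ⟨u, v, huv, hu1, rfl⟩
    suffices hle : ‖u‖ ≤ (D + 1) * ‖u - v‖ by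
      rw [hu1] at hle
      rwa [inv_le_iff_one_le_mul₀' (by positivity)]
    rcases huv with ⟨hu, hv⟩ | ⟨hu, hv⟩
    · refine (h u hu v hv).trans ?_
      gcongr
      linarith
    · exact h.symm u hu v (by rwa [compl_compl])

theorem isSeparated_of_inv_le_subspaceDist {x y : ℕ → X} {Γ : Set ℕ} {D : ℝ} (hD : 0 < D)
    (h : D⁻¹ ≤ subspaceDist (closedSpan 𝕜 x Γ) (closedSpan 𝕜 y Γᶜ)) :
    IsSeparated 𝕜 D x y Γ := by
  intro u hu v hv
  by_cases hu0 : u = 0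
  · rw [hu0, norm_zero]
    positivity
  have hpos := norm_pos_iff.2 hu0
  have hle : D⁻¹ ≤ ‖((‖u‖⁻¹ : ℝ) : 𝕜) • u - ((‖u‖⁻¹ : ℝ) : 𝕜) • v‖ := by
    refine h.trans (csInf_le ⟨0, ?_⟩ ⟨_, _, Or.inl ⟨Submodule.smul_mem _ _ hu,
      Submodule.smul_mem _ _ hv⟩, ?_, rfl⟩)
    · rintro _ ⟨_, _, -, -, rfl⟩
      exact norm_nonneg _
    · rw [norm_smul, RCLike.norm_ofReal, abs_of_pos (inv_pos.2 hpos), inv_mul_cancel₀ hpos.ne']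
  rw [← smul_sub, norm_smul, RCLike.norm_ofReal, abs_of_pos (inv_pos.2 hpos),
    le_inv_mul_iff₀ hpos, ← div_eq_mul_inv, div_le_iff₀ hD] at hle
  linarith

end Separation

/-! ### Basis projections and their restrictions. -/

section Projections

variable {𝕜 : Type*} [RCLike 𝕜] {X : Type*} [NormedAddCommGroup X] [NormedSpace 𝕜 X]

theorem SchauderBasis.apply_ne_zero (b : SchauderBasis 𝕜 X) (i : ℕ) : b i ≠ 0 :=
  b.linearIndependent.ne_zero i

theorem SchauderBasis.dense_span (b : SchauderBasis 𝕜 X) :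
    Dense (Submodule.span 𝕜 (range b) : Set X) := fun y =>
  mem_closure_of_tendsto ((seriesTo_iff _ _).1 (b.expansion y)) <| Filter.Eventually.of_forall
    fun _ => Submodule.sum_mem _ fun i _ =>
      Submodule.smul_mem _ _ (Submodule.subset_span (mem_range_self i))

variable {b : SchauderBasis 𝕜 X} {Γ : Set ℕ} {P : X →L[𝕜] X}

theorem IsBasisProjection.unique {P' : X →L[𝕜] X} (hP : IsBasisProjection b Γ P)
    (hP' : IsBasisProjection b Γ P') : P = P' :=
  ContinuousLinearMap.ext fun y => (hP y).unique (hP' y)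

theorem SeriesTo.mem_closedSpan {x : ℕ → X} {u : ℕ → X} {s : X} (h : SeriesTo u s)
    (hu : ∀ i, u i ∈ closedSpan 𝕜 x Γ) : s ∈ closedSpan 𝕜 x Γ :=
  (isClosed_closedSpan x Γ).mem_of_tendsto ((seriesTo_iff _ _).1 h) <|
    Filter.Eventually.of_forall fun _ => Submodule.sum_mem _ fun i _ => hu i

theorem IsBasisProjection.mem (hP : IsBasisProjection b Γ P) (y : X) :
    P y ∈ closedSpan 𝕜 b Γ :=
  (hP y).mem_closedSpan fun i => by
    by_cases hi : i ∈ Γ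
    · rw [indicator_of_mem hi]
      exact Submodule.smul_mem _ _ (_root_.mem_closedSpan 𝕜 b hi)
    · rw [indicator_of_notMem hi]
      exact Submodule.zero_mem _

theorem IsBasisProjection.sub_mem (hP : IsBasisProjection b Γ P) (y : X) :
    y - P y ∈ closedSpan 𝕜 b Γᶜ :=
  SeriesTo.mem_closedSpan (HasSum.sub (b.expansion y) (hP y)) fun i => by
    by_cases hi : i ∈ Γ
    · rw [indicator_of_mem hi, sub_self]
      exact Submodule.zero_mem _
    · rw [indicator_of_notMem hi, sub_zero]
      exact Submodule.smul_mem _ _ (_root_.mem_closedSpan 𝕜 b hi)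

theorem IsBasisProjection.apply_basis (hP : IsBasisProjection b Γ P) (i : ℕ) :
    P (b i) = Γ.indicator b i := by
  refine (hP (b i)).unique (HasSum.seriesTo ?_)
  have h := hasSum_single (f := Γ.indicator fun k => b.coord k (b i) • b k) i fun k hk => by
    simp [b.ortho, hk]
  convert h using 1
  by_cases hi : i ∈ Γ <;> simp [hi, b.ortho]

theorem IsBasisProjection.apply_of_mem (hP : IsBasisProjection b Γ P) {y : X}
    (hy : y ∈ closedSpan 𝕜 b Γ) : P y = y := by
  have : closedSpan 𝕜 b Γ ≤ (P - .id 𝕜 X : X →L[𝕜] X).ker :=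
    closedSpan_le (ContinuousLinearMap.isClosed_ker _) fun i hi => by
      simp [hP.apply_basis, hi]
  simpa [sub_eq_zero] using this hy

theorem IsBasisProjection.apply_of_mem_compl (hP : IsBasisProjection b Γ P) {y : X}
    (hy : y ∈ closedSpan 𝕜 b Γᶜ) : P y = 0 := by
  have : closedSpan 𝕜 b Γᶜ ≤ P.ker :=
    closedSpan_le (ContinuousLinearMap.isClosed_ker _) fun i hi => by
      rw [mem_compl_iff] at hi
      simp [hP.apply_basis, hi]
  exact this hy

theorem IsBasisProjection.hasSum [CompleteSpace X] (hb : IsUnconditional b)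
    (hP : IsBasisProjection b Γ P) (y : X) :
    HasSum (Γ.indicator fun i => b.coord i y • b i) (P y) := by
  obtain ⟨p, hp⟩ := (hb.hasSum y).summable.indicator Γ
  rwa [(hP y).unique hp.seriesTo]

/-- Since `y - P y` lies in the complementary span, separation bounds `‖y‖` by `D * ‖P y‖`.
Surjectivity is the splitting: `P` fixes the target vector and kills its complementary component. -/
theorem IsBasisProjection.restrictsToInvertible [CompleteSpace X] {b' : ℕ → X} {D : ℝ}
    (hD : 0 ≤ D) (hP : IsBasisProjection b Γ P) (hsep : IsSeparated 𝕜 D b' b Γ)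
    (hdec : ∀ w, ∃ y ∈ closedSpan 𝕜 b' Γ, ∃ v ∈ closedSpan 𝕜 b Γᶜ, w = y + v) :
    RestrictsToInvertible P (closedSpan 𝕜 b' Γ) (closedSpan 𝕜 b Γ) D := by
  have : CompleteSpace (closedSpan 𝕜 b' Γ) := (isClosed_closedSpan b' Γ).completeSpace_coe
  have : CompleteSpace (closedSpan 𝕜 b Γ) := (isClosed_closedSpan (b : ℕ → X) Γ).completeSpace_coe
  let f : closedSpan 𝕜 b' Γ →L[𝕜] closedSpan 𝕜 b Γ :=
    (P.comp (closedSpan 𝕜 b' Γ).subtypeL).codRestrict _ fun y => hP.mem y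
  have hf : ∀ y, (f y : X) = P y := fun y => rfl
  have hbound : ∀ y, ‖y‖ ≤ D * ‖f y‖ := fun y => by
    have := hsep y y.2 _ (hP.sub_mem y)
    rwa [sub_sub_cancel] at this
  have hker : f.ker = ⊥ := by
    refine LinearMap.ker_eq_bot'.2 fun y hy => ?_
    have h := hbound y
    have hy' : f y = 0 := hy
    rw [hy', norm_zero, mul_zero] at h
    exact norm_le_zero_iff.1 h
  have hrange : f.range = ⊤ := by
    refine LinearMap.range_eq_top.2 fun z => ?_
    obtain ⟨y, hy, v, hv, hz⟩ := hdec z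
    refine ⟨⟨y, hy⟩, Subtype.ext ?_⟩
    change P y = z
    have := hP.apply_of_mem z.2
    rwa [hz, map_add, hP.apply_of_mem_compl hv, add_zero, ← hz] at this
  let T := ContinuousLinearEquiv.ofBijective f hker hrange
  have hT : ∀ y, T y = f y := fun y => rfl
  refine ⟨T, fun y => hf y, ContinuousLinearMap.opNorm_le_bound _ hD fun z => ?_⟩
  have := hbound (T.symm z)
  rwa [← hT, T.apply_symm_apply] at this

theorem RestrictsToInvertible.norm_le {Y Z : Submodule 𝕜 X} {E : ℝ}
    (h : RestrictsToInvertible P Y Z E) {y : X} (hy : y ∈ Y) : ‖y‖ ≤ E * ‖P y‖ := by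
  obtain ⟨T, hT, hE⟩ := h
  have h := (T.symm : Z →L[𝕜] Y).le_of_opNorm_le hE (T ⟨y, hy⟩)
  rw [← Submodule.norm_coe (T ⟨y, hy⟩), hT] at h
  simpa using h

end Projections

/-! ### Splittings and frame operators of weavings. -/

section Weaving

variable {𝕜 : Type*} [RCLike 𝕜] {X : Type*} [NormedAddCommGroup X] [NormedSpace 𝕜 X]
  {b : Fin 2 → SchauderBasis 𝕜 X}

theorem exists_common_isSuppressionUnconditional [CompleteSpace X]
    (hb : ∀ j, IsUnconditional (b j)) :
    ∃ L, 0 ≤ L ∧ ∀ j, IsSuppressionUnconditional 𝕜 L (b j) := by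
  choose L hL0 hL using fun j => (hb j).exists_isSuppressionUnconditional
  refine ⟨L 0 + L 1, add_nonneg (hL0 0) (hL0 1), fun j a s t hst => (hL j a s t hst).trans
    (mul_le_mul_of_nonneg_right ?_ (norm_nonneg _))⟩
  rcases Fin.exists_fin_two.1 ⟨j, rfl⟩ with h | h <;> rw [h]
  · exact le_add_of_nonneg_right (hL0 1)
  · exact le_add_of_nonneg_left (hL0 0)

/-- Uniformly separated unconditional bases are woven, with a uniform constant. -/
theorem exists_isKUnconditionalBasis_of_isSeparated [CompleteSpace X]
    (hb : ∀ j, IsUnconditional (b j)) {D : ℝ}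
    (hD : 0 ≤ D) (h : ∀ σ : ℕ → Fin 2, IsSeparated 𝕜 D (b 0) (b 1) (σ ⁻¹' {0})) :
    ∃ K : ℝ, 0 < K ∧ ∀ σ : ℕ → Fin 2, IsKUnconditionalBasis 𝕜 K (fun i => b (σ i) i) := by
  obtain ⟨L, hL0, hL⟩ := exists_common_isSuppressionUnconditional hb
  have hU : ∀ σ : ℕ → Fin 2, IsSuppressionUnconditional 𝕜 (L * (2 * D + 1))
      (fun i => b (σ i) i) := fun σ => by
    refine IsSeparated.isSuppressionUnconditional (x := fun j => (b j : ℕ → X)) (h σ) hL0 hL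
  have hx : ∀ j i, b j i ≠ 0 := fun j => SchauderBasis.apply_ne_zero (b j)
  refine ⟨2 * (L * (2 * D + 1)) + 1, by positivity, fun σ =>
    (hU σ).exists_basis (fun i => hx _ _) ?_⟩
  exact dense_span_weaving (x := fun j => (b j : ℕ → X)) hx (by positivity) hU
    (SchauderBasis.dense_span (b 0)) σ

/-- A vector splits along the two parts of a weaving that is an unconditional basis. -/
theorem exists_eq_add_of_isKUnconditionalBasis {K : ℝ} {σ : ℕ → Fin 2}
    (h : IsKUnconditionalBasis 𝕜 K (fun i => b (σ i) i)) (w : X) :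
    ∃ u ∈ closedSpan 𝕜 (b 0) (σ ⁻¹' {0}), ∃ v ∈ closedSpan 𝕜 (b 1) (σ ⁻¹' {0})ᶜ, w = u + v := by
  obtain ⟨z, hz, hK⟩ := h
  obtain ⟨P, hP, -⟩ := hK.exists_isBasisProjection (σ ⁻¹' {0})
  refine ⟨P w, ?_, w - P w, ?_, (add_sub_cancel _ _).symm⟩
  · have e : closedSpan 𝕜 z (σ ⁻¹' {0}) = closedSpan 𝕜 (b 0) (σ ⁻¹' {0}) :=
      closedSpan_congr fun i (hi : σ i = 0) => by simp only [hz, hi]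
    rw [← e]
    exact hP.mem w
  · have e : closedSpan 𝕜 z (σ ⁻¹' {1}) = closedSpan 𝕜 (b 1) (σ ⁻¹' {1}) :=
      closedSpan_congr fun i (hi : σ i = 1) => by simp only [hz, hi]
    rw [← preimage_one_eq_compl, ← e, preimage_one_eq_compl]
    exact hP.sub_mem w

theorem exists_preimage_zero_eq (Γ : Set ℕ) : ∃ σ : ℕ → Fin 2, σ ⁻¹' {0} = Γ := by
  classical
  refine ⟨fun i => if i ∈ Γ then 0 else 1, ?_⟩
  ext i
  by_cases hi : i ∈ Γ <;> simp [hi]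

theorem seriesTo_weaving {σ : ℕ → Fin 2} {P Q : X →L[𝕜] X}
    (hP : IsBasisProjection (b 0) (σ ⁻¹' {0}) P) (hQ : IsBasisProjection (b 1) (σ ⁻¹' {0})ᶜ Q)
    (y : X) : SeriesTo (fun i => (b (σ i)).coord i y • b (σ i) i) (P y + Q y) :=
  SeriesTo.congr (HasSum.add (hP y) (hQ y)) fun i => by
    rcases Fin.exists_fin_two.1 ⟨σ i, rfl⟩ with hi | hi <;> simp [hi]

theorem hasSum_weaving [CompleteSpace X]
    (hb : ∀ j, IsUnconditional (b j)) {σ : ℕ → Fin 2} {P Q : X →L[𝕜] X}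
    (hP : IsBasisProjection (b 0) (σ ⁻¹' {0}) P) (hQ : IsBasisProjection (b 1) (σ ⁻¹' {0})ᶜ Q)
    (y : X) : HasSum (fun i => (b (σ i)).coord i y • b (σ i) i) (P y + Q y) := by
  convert (hP.hasSum (hb 0) y).add (hQ.hasSum (hb 1) y) using 2 with i
  rcases Fin.exists_fin_two.1 ⟨σ i, rfl⟩ with hi | hi <;> simp [hi]

/-- The frame operators of separated bases with splitting are invertible. -/
theorem isUnconditionalApproxSchauderFrame_of_isSeparated [CompleteSpace X]
    (hb : ∀ j, IsUnconditional (b j))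
    {D : ℝ} {σ : ℕ → Fin 2} {P Q : X →L[𝕜] X}
    (hP : IsBasisProjection (b 0) (σ ⁻¹' {0}) P) (hQ : IsBasisProjection (b 1) (σ ⁻¹' {0})ᶜ Q)
    (hsep : ∀ Γ, IsSeparated 𝕜 D (b 0) (b 1) Γ)
    (hdec : ∀ Γ w, ∃ u ∈ closedSpan 𝕜 (b 0) Γ, ∃ v ∈ closedSpan 𝕜 (b 1) Γᶜ, w = u + v) :
    IsUnconditionalApproxSchauderFrame (fun i => b (σ i) i) (fun i => (b (σ i)).coord i) := by
  set Γ := σ ⁻¹' {0}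
  -- Separation along `Γ` makes `P t` and `Q t` vanish separately; then `t` lies in both parts of
  -- the opposite weaving, and separation along `Γᶜ` gives `t = 0`.
  have hker : (P + Q).ker = ⊥ := by
    refine LinearMap.ker_eq_bot'.2 fun t ht => ?_
    have ht : P t + Q t = 0 := ht
    have hPt : P t = 0 := by
      have h := hsep Γ _ (hP.mem t) _ (Submodule.neg_mem _ (hQ.mem t))
      rw [sub_neg_eq_add, ht, norm_zero, mul_zero] at h
      exact norm_le_zero_iff.1 h
    have hQt : Q t = 0 := by rwa [hPt, zero_add] at ht
    have h0 := hP.sub_mem t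
    have h1 := hQ.sub_mem t
    rw [hPt, sub_zero] at h0
    rw [hQt, sub_zero] at h1
    have h := hsep Γᶜ _ h0 _ h1
    rw [sub_self, norm_zero, mul_zero] at h
    exact norm_le_zero_iff.1 h
  have hrange : (P + Q).range = ⊤ := by
    refine LinearMap.range_eq_top.2 fun w => ?_
    obtain ⟨u, hu, v, hv, rfl⟩ := hdec Γ w
    -- Splitting `u - v` along the opposite weaving makes `u - p = v + q`: the first form is sent to
    -- `u` by `P`, the second to `v` by `Q`.
    obtain ⟨p, hp, q, hq, huv⟩ := hdec Γᶜ (u - v)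
    refine ⟨u - p, ?_⟩
    have h1 : P (u - p) = u := by
      rw [map_sub, hP.apply_of_mem hu, hP.apply_of_mem_compl hp, sub_zero]
    have h2 : Q (u - p) = v := by
      have e : u - p = v + q := by
        rw [sub_eq_iff_eq_add] at huv ⊢
        rw [huv]
        abel
      rw [e, map_add, hQ.apply_of_mem hv, hQ.apply_of_mem_compl hq, add_zero]
    change P (u - p) + Q (u - p) = u + v
    rw [h1, h2]
  exact ⟨ContinuousLinearEquiv.ofBijective (P + Q) hker hrange, seriesTo_weaving hP hQ,
    fun y π => (hasSum_weaving hb hP hQ y).seriesTo_perm π⟩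

/-- If the frame operator of the opposite weaving is invertible, then the parts of a weaving are
separated. -/
theorem IsUnconditionalApproxSchauderFrame.exists_isSeparated {τ : ℕ → Fin 2} {P Q : X →L[𝕜] X}
    (hP : IsBasisProjection (b 0) (τ ⁻¹' {0}) P) (hQ : IsBasisProjection (b 1) (τ ⁻¹' {0})ᶜ Q)
    (h : IsUnconditionalApproxSchauderFrame (fun i => b (τ i) i) (fun i => (b (τ i)).coord i)) :
    ∃ D, 0 ≤ D ∧ IsSeparated 𝕜 D (b 0) (b 1) (τ ⁻¹' {0})ᶜ := by
  obtain ⟨S, hS, -⟩ := h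
  refine ⟨‖(S.symm : X →L[𝕜] X)‖ * ‖Q‖, by positivity, fun u hu v hv => ?_⟩
  -- On the part of the first basis opposite to `τ` the frame operator reduces to `Q`, which kills
  -- `v`.
  have hSu : S u = Q (u - v) := by
    rw [(hS u).unique (seriesTo_weaving hP hQ u), hP.apply_of_mem_compl hu, zero_add, map_sub,
      hQ.apply_of_mem_compl hv, sub_zero]
  calc ‖u‖ = ‖(S.symm : X →L[𝕜] X) (S u)‖ := by simp
    _ ≤ ‖(S.symm : X →L[𝕜] X)‖ * ‖Q (u - v)‖ := hSu ▸ ContinuousLinearMap.le_opNorm _ _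
    _ ≤ ‖(S.symm : X →L[𝕜] X)‖ * ‖Q‖ * ‖u - v‖ := by
      rw [mul_assoc]
      gcongr
      exact Q.le_opNorm _

end Weaving

/-! ### The equivalences, with separation as the hub. -/

theorem theoremT {𝕜 : Type*} [RCLike 𝕜] {X : Type*} [NormedAddCommGroup X] [NormedSpace 𝕜 X]
    [CompleteSpace X] (C : ℝ) (b : Fin 2 → SchauderBasis 𝕜 X)
    (hb : ∀ j, IsKUnconditional C (b j)) :
    List.TFAE [
      -- (i) every weaving is an unconditional basis
      ∀ σ : ℕ → Fin 2, IsUnconditionalBasis 𝕜 (fun i => b (σ i) i),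
      -- (ii) every weaving is an unconditional basis, with a uniform constant
      ∃ K : ℝ, 0 < K ∧ ∀ σ : ℕ → Fin 2, IsKUnconditionalBasis 𝕜 K (fun i => b (σ i) i),
      -- (iii) every weaving of the Schauder frames is an unconditional approximate Schauder frame
      ∀ σ : ℕ → Fin 2,
        IsUnconditionalApproxSchauderFrame (fun i => b (σ i) i) (fun i => (b (σ i)).coord i),
      -- (iv) every weaving is an unconditional basic sequence
      ∀ σ : ℕ → Fin 2, IsUnconditionalBasicSequence 𝕜 (fun i => b (σ i) i),
      -- (v) the distances of the complementary closed spans are uniformly bounded below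
      ∃ D : ℝ, 0 < D ∧ ∀ σ : ℕ → Fin 2,
        D⁻¹ ≤ subspaceDist (closedSpan 𝕜 (b 0) (σ ⁻¹' {0})) (closedSpan 𝕜 (b 1) (σ ⁻¹' {1})),
      -- (vi) the basis projections restrict to uniformly invertible operators
      ∃ E : ℝ, 0 < E ∧ ∀ σ : ℕ → Fin 2, ∃ P Q : X →L[𝕜] X,
        IsBasisProjection (b 0) (σ ⁻¹' {0}) P ∧
        IsBasisProjection (b 1) (σ ⁻¹' {0}) Q ∧
        RestrictsToInvertible P (closedSpan 𝕜 (b 1) (σ ⁻¹' {0}))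
          (closedSpan 𝕜 (b 0) (σ ⁻¹' {0})) E ∧
        RestrictsToInvertible Q (closedSpan 𝕜 (b 0) (σ ⁻¹' {0}))
          (closedSpan 𝕜 (b 1) (σ ⁻¹' {0})) E] := by
  have hb1 : ∀ j, IsUnconditional (b j) := fun j => (hb j).1
  have hx : ∀ j i, b j i ≠ 0 := fun j => SchauderBasis.apply_ne_zero (b j)
  obtain ⟨L, hL0, hL⟩ := exists_common_isSuppressionUnconditional hb1
  have hproj := fun j Γ => (hb j).exists_isBasisProjection Γ
  have hsepD : ∀ {D : ℝ}, 0 < D → (∀ σ : ℕ → Fin 2, D⁻¹ ≤ subspaceDist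
      (closedSpan 𝕜 (b 0) (σ ⁻¹' {0})) (closedSpan 𝕜 (b 1) (σ ⁻¹' {1}))) →
      ∀ Γ, IsSeparated 𝕜 D (b 0) (b 1) Γ := fun hD h Γ => by
    obtain ⟨σ, rfl⟩ := exists_preimage_zero_eq Γ
    exact isSeparated_of_inv_le_subspaceDist hD (by rw [← preimage_one_eq_compl]; exact h σ)
  have hdistD : ∀ {D : ℝ}, 0 ≤ D → (∀ σ : ℕ → Fin 2,
      IsSeparated 𝕜 D (b 0) (b 1) (σ ⁻¹' {0})) → ∃ D : ℝ, 0 < D ∧ ∀ σ : ℕ → Fin 2,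
      D⁻¹ ≤ subspaceDist (closedSpan 𝕜 (b 0) (σ ⁻¹' {0})) (closedSpan 𝕜 (b 1) (σ ⁻¹' {1})) :=
    fun {D} hD h => ⟨D + 1, by positivity, fun σ => by
      rw [preimage_one_eq_compl]
      exact (h σ).inv_le_subspaceDist hD (hx 0) (hx 1)⟩
  have hdec : ∀ {D : ℝ}, 0 < D → (∀ Γ, IsSeparated 𝕜 D (b 0) (b 1) Γ) → ∀ Γ w,
      ∃ u ∈ closedSpan 𝕜 (b 0) Γ, ∃ v ∈ closedSpan 𝕜 (b 1) Γᶜ, w = u + v := fun hD h Γ w => by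
    obtain ⟨K, -, hK⟩ := exists_isKUnconditionalBasis_of_isSeparated hb1 hD.le fun σ => h _
    obtain ⟨σ, rfl⟩ := exists_preimage_zero_eq Γ
    exact exists_eq_add_of_isKUnconditionalBasis (hK σ) w
  tfae_have 2 → 1 := fun ⟨K, _, h⟩ σ => by
    obtain ⟨z, hz, hK⟩ := h σ
    exact ⟨z, hz, hK.1⟩
  tfae_have 1 → 4 := fun h σ => by
    obtain ⟨L, -, hL⟩ := (h σ).exists_isSuppressionUnconditional
    exact hL.isUnconditionalBasicSequence fun i => hx _ _
  tfae_have 4 → 5 := fun h => by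
    obtain ⟨D, hD, hle⟩ := exists_norm_weavingPart_le (x := fun j => (b j : ℕ → X)) hx
      fun τ => (h τ).exists_isSuppressionUnconditional
    exact hdistD hD fun σ =>
      isSeparated_of_norm_weavingPart_le (x := fun j => (b j : ℕ → X)) (hle σ)
  tfae_have 5 → 2 := fun ⟨D, hD, h⟩ =>
    exists_isKUnconditionalBasis_of_isSeparated hb1 hD.le fun σ => hsepD hD h _
  tfae_have 5 → 3 := fun ⟨D, hD, h⟩ σ => by
    obtain ⟨P, hP, -⟩ := hproj 0 (σ ⁻¹' {0})
    obtain ⟨Q, hQ, -⟩ := hproj 1 (σ ⁻¹' {0})ᶜ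
    exact isUnconditionalApproxSchauderFrame_of_isSeparated hb1 hP hQ (hsepD hD h)
      (hdec hD (hsepD hD h))
  tfae_have 3 → 4 := fun h σ => by
    -- The frame operator of the opposite weaving controls `σ`. The constant depends on `σ`;
    -- uniformity is recovered by the implication from (iv) to (v).
    obtain ⟨τ, hτ⟩ := exists_preimage_zero_eq (σ ⁻¹' {0})ᶜ
    obtain ⟨P, hP, -⟩ := hproj 0 (τ ⁻¹' {0})
    obtain ⟨Q, hQ, -⟩ := hproj 1 (τ ⁻¹' {0})ᶜ
    obtain ⟨D, -, hD⟩ := (h τ).exists_isSeparated hP hQ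
    rw [hτ, compl_compl] at hD
    have hU := IsSeparated.isSuppressionUnconditional (x := fun j => (b j : ℕ → X)) hD hL0 hL
    exact hU.isUnconditionalBasicSequence fun i => hx _ _
  tfae_have 5 → 6 := fun ⟨D, hD, h⟩ => by
    have hsep := hsepD hD h
    have hsplit := hdec hD hsep
    -- Exchanging the roles of the two bases in the separation inequality costs the extra `1`.
    refine ⟨D + 1, by positivity, fun σ => ?_⟩
    obtain ⟨P, hP, -⟩ := hproj 0 (σ ⁻¹' {0})
    obtain ⟨Q, hQ, -⟩ := hproj 1 (σ ⁻¹' {0})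
    refine ⟨P, Q, hP, hQ, hP.restrictsToInvertible (by positivity) ?_ fun w => ?_,
      hQ.restrictsToInvertible (by positivity) ?_ (hsplit _)⟩
    · simpa only [compl_compl] using (hsep (σ ⁻¹' {0})ᶜ).symm
    · obtain ⟨u, hu, v, hv, hw⟩ := hsplit (σ ⁻¹' {0})ᶜ w
      exact ⟨v, by rwa [compl_compl] at hv, u, hu, by rw [hw, add_comm]⟩
    · intro u hu v hv
      refine (hsep _ u hu v hv).trans ?_
      gcongr
      linarith
  tfae_have 6 → 5 := fun ⟨E, hE, h⟩ => by
    -- `Q` kills `v`, so `‖u‖ ≤ E * ‖Q (u - v)‖`, and `(1 + C) / 2` bounds the norm of `Q`; the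
    -- absolute value makes the constant visibly nonnegative.
    refine hdistD (D := E * |(1 + C) / 2|) (by positivity) fun σ u hu v hv => ?_
    obtain ⟨-, Q, -, hQ, -, hQE⟩ := h σ
    obtain ⟨Q', hQ', hQC⟩ := hproj 1 (σ ⁻¹' {0})
    rw [← hQ.unique hQ'] at hQC
    have hQu : Q u = Q (u - v) := by rw [map_sub, hQ.apply_of_mem_compl hv, sub_zero]
    calc ‖u‖ ≤ E * ‖Q (u - v)‖ := hQu ▸ hQE.norm_le hu
      _ ≤ E * |(1 + C) / 2| * ‖u - v‖ := by
        rw [mul_assoc]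
        gcongr
        exact (hQC _).trans (by gcongr; exact le_abs_self _)
  tfae_finish
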